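/- **Setting.** Let $\Omega\subset\mathbb R$ be a bounded interval with non-empty interior and $\omega$ a measurable weight on $\Omega$, positive in the interior, with $\int_\Omega|x|^q\omega\,dx<\infty$ for all $q\ge 0$. Write $\langle f,g\rangle_\omega=\int_\Omega fg\,\omega\,dx$, $\|f\|_{L^2_\omega}=\langle f,f\rangle_\omega^{1/2}$, $\langle f,g\rangle=\int_\Omega fg\,dx$. For an integer $r\ge0$, $H^r_\omega(\Omega)$ is the space of $f$ whose weak derivatives $f^{(j)}$, $0\le j\le r$, exist in the interior of $\Omega$ and lie in $L^2_\omega(\Omega)$, with $\|f\|_{H^r_\omega}^2=\sum_{j=0}^r\|f^{(j)}\|_{L^2_\omega}^2$. Let $\phi_0,\phi_1,\dots$ be polynomials with $\deg\phi_k=k$ and $\langle\phi_h,\phi_k\rangle_\omega=0$ for $h\ne k$, and let $S_N=\mathrm{span}\{\phi_0,\dots,\phi_N\}$. Put $$\hat f_k=\frac{\langle f,\phi_k\rangle_\omega}{\|\phi_k\|^2_{L^2_\omega}},\qquad f_N=\sum_{k=0}^N\hat f_k\phi_k .$$ Let $\Phi=(1,x,\dots,x^Q)^T$, $\hat\Phi_k=\langle\phi_k,\Phi\rangle\in\mathbb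 R^{Q+1}$, $\|\Phi\|_{2,L^2_\omega}^2=\sum_{q=0}^Q\|x^q\|_{L^2_\omega}^2$, and $$M=\sum_{h=0}^N\frac{\hat\Phi_h\hat\Phi_h^T}{\|\phi_h\|^2_{L^2_\omega}},\qquad \hat C_k^T=\frac{1}{\|\phi_k\|^2_{L^2_\omega}}\hat\Phi_k^TM^{-1},\qquad f_N^c=\sum_{k=0}^N\Big(\hat f_k+\hat C_k^T\big(\langle f,\Phi\rangle-\langle f_N,\Phi\rangle\big)\Big)\phi_k .$$ Throughout $N\ge Q$, $f\in L^2_\omega(\Omega)$, and $f$ is integrable on $\Omega$ for Lebesgue measure, so that its moments $\langle f,\Phi\rangle$ exist; $\rho(M^{-1})$ is the spectral radius of $M^{-1}$. For $N\ge1$ and $C>0$ we say that the *moments are accurate* (at $N$, with constant $C$) if, in the Euclidean norm, $$\|\langle f,\Phi\rangle-\langle f_N,\Phi\rangle\|\le \frac{C}{N^{r}}\,\|f\|_{H^r_\omega}\,\|\Phi\|_{2,L^2_\omega}.$$ **Theorem.** 1. (Jacobi weights.) Let $\Omega=[-1,1]$ and $\omega(x)=(1-x)^\alpha(1+x)^\beta$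 with $\alpha,\beta>-1$, let $r\ge0$ be an integer and $C>0$. There is a function $K:\mathbb R^2\to\mathbb R$, nondecreasing in both arguments and depending only on $\alpha,\beta,r,C$, such that for all $N\ge\max(Q,1)$ and all $f\in H^r_\omega(\Omega)$, integrable on $\Omega$, whose moments are accurate at $N$ with constant $C$, $$\|f-f_N^c\|_{L^2_\omega}\le\frac{C_\Phi}{N^r}\,\|f\|_{H^r_\omega},\qquad C_\Phi=K\big(\rho(M^{-1}),\|\Phi\|_{2,L^2_\omega}\big).$$ 2. (General weights.) For all $C_0,C>0$ there is a function $K:\mathbb R^2\to\mathbb R$, nondecreasing in both arguments and depending only on $C_0$ and $C$, such that the same estimate holds for every $\Omega,\omega,(\phi_k)$ as above, every $r\ge 0$, every $N\ge\max(Q,1)$ and every $f\in H^r_\omega(\Omega)$, integrable on $\Omega$, whose moments are accurate at $N$ with constant $C$ and whose truncated expansion satisfies $\|f-f_N\|_{L^2_\omega}\le C_0N^{-r}\|f\|_{H^r_\omega}$. 3. For every $\Omega,\omega,(\phi_k)$ as above and $N\ge Q\ge 0$, the matrix $M$ is symmetric positive definite (so $f_N^c$ is well defined), and for every $f\in L^2_\omega(\Omega)$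 integrable on $\Omega$, $f_N^c$ is the unique minimizer of $\|g-f\|_{L^2_\omega}$ over all $g\in S_N$ with $\langle g,x^q\rangle=\langle f,x^q\rangle$, $q=0,\dots,Q$. -/

import Mathlib

noncomputable section

namespace ConservativeApprox

/-- The inner product `∫_Ω f g w dx` of the weighted space `L²_w(Ω)`. -/
def wInner (Ω : Set ℝ) (w f g : ℝ → ℝ) : ℝ := ∫ x in Ω, f x * g x * w x

/-- The norm of `L²_w(Ω)`. -/
def wNorm (Ω : Set ℝ) (w f : ℝ → ℝ) : ℝ := Real.sqrt (wInner Ω w f f)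

/-- Membership in `L²_w(Ω)`. -/
def MemL2 (Ω : Set ℝ) (w f : ℝ → ℝ) : Prop :=
  MeasureTheory.AEStronglyMeasurable f (MeasureTheory.volume.restrict Ω) ∧
    MeasureTheory.IntegrableOn (fun x => f x ^ 2 * w x) Ω

/-- A nondegenerate bounded interval `Ω` with a positive weight `w` all of whose moments are
finite.  (The values of `w` at the end points of `Ω` are irrelevant.) -/
structure IsWeight (Ω : Set ℝ) (w : ℝ → ℝ) : Prop where
  interval : Ω.OrdConnected
  nondegenerate : (interior Ω).Nonempty
  bounded : Bornology.IsBounded Ω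
  measurable : AEMeasurable w (MeasureTheory.volume.restrict Ω)
  pos : ∀ x ∈ interior Ω, 0 < w x
  moments : ∀ q : ℕ, MeasureTheory.IntegrableOn (fun x => |x| ^ q * w x) Ω

/-- The Jacobi weight `(1 - x)^α (1 + x)^β`, to be used on `[-1, 1]`. -/
def jacobiWeight (α β : ℝ) (x : ℝ) : ℝ := (1 - x) ^ α * (1 + x) ^ β

/-- `g` is the `j`-th weak derivative of `f` on the open set `U`. -/
def IsWeakDeriv (U : Set ℝ) (j : ℕ) (f g : ℝ → ℝ) : Prop :=
  MeasureTheory.LocallyIntegrableOn f U ∧ MeasureTheory.LocallyIntegrableOn g U ∧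
    ∀ ψ : ℝ → ℝ, ContDiff ℝ (⊤ : ℕ∞) ψ → HasCompactSupport ψ → tsupport ψ ⊆ U →
      ∫ x in U, f x * iteratedDeriv j ψ x = (-1) ^ j * ∫ x in U, g x * ψ x

open Classical in
/-- The `j`-th weak derivative of `f` on `U` (unique up to null sets; `0` if there is none). -/
def weakDeriv (U : Set ℝ) (j : ℕ) (f : ℝ → ℝ) : ℝ → ℝ :=
  if h : ∃ g, IsWeakDeriv U j f g then Classical.choose h else 0

/-- Membership in the weighted Sobolev space `H^r_w(Ω)`: the weak derivatives of order `0, …, r`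
exist in the interior of `Ω` and lie in `L²_w(Ω)`. -/
def MemSobolev (Ω : Set ℝ) (w : ℝ → ℝ) (r : ℕ) (f : ℝ → ℝ) : Prop :=
  MemL2 Ω w f ∧ ∀ j ≤ r, ∃ g, IsWeakDeriv (interior Ω) j f g ∧ MemL2 Ω w g

/-- The norm of `H^r_w(Ω)`. -/
def sobolevNorm (Ω : Set ℝ) (w : ℝ → ℝ) (r : ℕ) (f : ℝ → ℝ) : ℝ :=
  Real.sqrt (∑ j ∈ Finset.range (r + 1), wNorm Ω w (weakDeriv (interior Ω) j f) ^ 2)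

/-- The function of a polynomial. -/
def pfun (p : Polynomial ℝ) : ℝ → ℝ := fun x => p.eval x

/-- `φ 0, φ 1, …` are orthogonal polynomials for `L²_w(Ω)`, with `φ k` of exact degree `k`
(with an arbitrary normalization). -/
structure IsOrthogonalFamily (Ω : Set ℝ) (w : ℝ → ℝ) (φ : ℕ → Polynomial ℝ) : Prop where
  degree : ∀ k, (φ k).degree = k
  orthogonal : ∀ h k, h ≠ k → wInner Ω w (pfun (φ h)) (pfun (φ k)) = 0

/-- The space `S_N` spanned by `φ 0, …, φ N`. -/
def polySpace (φ : ℕ → Polynomial ℝ) (N : ℕ) : Submodule ℝ (ℝ → ℝ) :=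
  Submodule.span ℝ {p | ∃ k ≤ N, p = pfun (φ k)}

/-- The vector `(⟨f, 1⟩, ⟨f, x⟩, …, ⟨f, x^Q⟩)` of unweighted moments, with its Euclidean norm. -/
def momentVec (Ω : Set ℝ) (Q : ℕ) (f : ℝ → ℝ) : EuclideanSpace ℝ (Fin (Q + 1)) :=
  WithLp.toLp 2 (fun q => ∫ x in Ω, f x * x ^ (q : ℕ))

/-- `‖Φ‖_{2,L²_w}` for `Φ = (1, x, …, x^Q)`. -/
def phiNorm (Ω : Set ℝ) (w : ℝ → ℝ) (Q : ℕ) : ℝ :=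
  Real.sqrt (∑ q ∈ Finset.range (Q + 1), wNorm Ω w (fun x => x ^ q) ^ 2)

/-- The coefficient `⟨f, φ_k⟩_w / ‖φ_k‖²`. -/
def coeff (Ω : Set ℝ) (w : ℝ → ℝ) (φ : ℕ → Polynomial ℝ) (f : ℝ → ℝ) (k : ℕ) : ℝ :=
  wInner Ω w f (pfun (φ k)) / wNorm Ω w (pfun (φ k)) ^ 2

/-- The truncated expansion `f_N`. -/
def truncation (Ω : Set ℝ) (w : ℝ → ℝ) (φ : ℕ → Polynomial ℝ) (N : ℕ) (f : ℝ → ℝ) : ℝ → ℝ :=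
  fun x => ∑ k ∈ Finset.range (N + 1), coeff Ω w φ f k * pfun (φ k) x

/-- The vector `Φ̂_k` of the moments of `φ_k`. -/
def phiHat (Ω : Set ℝ) (φ : ℕ → Polynomial ℝ) (Q k : ℕ) : Fin (Q + 1) → ℝ :=
  fun q => momentVec Ω Q (pfun (φ k)) q

/-- The matrix `M = ∑_{h ≤ N} Φ̂_h Φ̂_hᵀ / ‖φ_h‖²`. -/
def constraintMatrix (Ω : Set ℝ) (w : ℝ → ℝ) (φ : ℕ → Polynomial ℝ) (Q N : ℕ) :
    Matrix (Fin (Q + 1)) (Fin (Q + 1)) ℝ :=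
  ∑ h ∈ Finset.range (N + 1), (1 / wNorm Ω w (pfun (φ h)) ^ 2) •
    Matrix.vecMulVec (phiHat Ω φ Q h) (phiHat Ω φ Q h)

/-- The spectral radius of `M⁻¹`.  As `M⁻¹` is symmetric, its eigenvalues are real. -/
def invSpectralRadius (Ω : Set ℝ) (w : ℝ → ℝ) (φ : ℕ → Polynomial ℝ) (Q N : ℕ) : ℝ :=
  (spectralRadius ℝ (constraintMatrix Ω w φ Q N)⁻¹).toReal

/-- The row vector `Ĉ_kᵀ = Φ̂_kᵀ M⁻¹ / ‖φ_k‖²`. -/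
def cHat (Ω : Set ℝ) (w : ℝ → ℝ) (φ : ℕ → Polynomial ℝ) (Q N k : ℕ) : Fin (Q + 1) → ℝ :=
  (1 / wNorm Ω w (pfun (φ k)) ^ 2) •
    Matrix.vecMul (phiHat Ω φ Q k) (constraintMatrix Ω w φ Q N)⁻¹

/-- The moment constrained coefficient
`f̂_k^c = f̂_k + Ĉ_kᵀ (⟨f, Φ⟩ - ⟨f_N, Φ⟩)`. -/
def constrainedCoeff (Ω : Set ℝ) (w : ℝ → ℝ) (φ : ℕ → Polynomial ℝ) (Q N : ℕ) (f : ℝ → ℝ)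
    (k : ℕ) : ℝ :=
  coeff Ω w φ f k +
    ∑ q : Fin (Q + 1), cHat Ω w φ Q N k q *
      (momentVec Ω Q f q - momentVec Ω Q (truncation Ω w φ N f) q)

/-- The conservative orthogonal projection `f_N^c`. -/
def constrainedProj (Ω : Set ℝ) (w : ℝ → ℝ) (φ : ℕ → Polynomial ℝ) (Q N : ℕ) (f : ℝ → ℝ) :
    ℝ → ℝ :=
  fun x => ∑ k ∈ Finset.range (N + 1), constrainedCoeff Ω w φ Q N f k * pfun (φ k) x

/-- `g` is the unique minimizer of `‖g - f‖_{L²_w}` among the elements of `S_N` that have the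
same moments of order `0, …, Q` as `f`. -/
def IsConstrainedBestApprox (Ω : Set ℝ) (w : ℝ → ℝ) (φ : ℕ → Polynomial ℝ) (Q N : ℕ)
    (f g : ℝ → ℝ) : Prop :=
  g ∈ polySpace φ N ∧ momentVec Ω Q g = momentVec Ω Q f ∧
    ∀ g' ∈ polySpace φ N, momentVec Ω Q g' = momentVec Ω Q f → g' ≠ g →
      wNorm Ω w (f - g) < wNorm Ω w (f - g')

/-- The moments of `f_N` approximate those of `f` at the rate `N^{-r}` with the constant `C`. -/
def MomentAccuracy (Ω : Set ℝ) (w : ℝ → ℝ) (φ : ℕ → Polynomial ℝ) (r Q N : ℕ) (C : ℝ)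
    (f : ℝ → ℝ) : Prop :=
  ‖momentVec Ω Q f - momentVec Ω Q (truncation Ω w φ N f)‖ ≤
    C / (N : ℝ) ^ r * sobolevNorm Ω w r f * phiNorm Ω w Q

/-- The truncated expansion `f_N` approximates `f` at the rate `N^{-r}` with the constant `C`. -/
def TruncationAccuracy (Ω : Set ℝ) (w : ℝ → ℝ) (φ : ℕ → Polynomial ℝ) (r N : ℕ) (C : ℝ)
    (f : ℝ → ℝ) : Prop :=
  wNorm Ω w (f - truncation Ω w φ N f) ≤ C / (N : ℝ) ^ r * sobolevNorm Ω w r f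

end ConservativeApprox

end

open ConservativeApprox

/-!
The correction `f_N^c - f_N` is the element of `S_N` that represents the functional
`p ↦ y · ⟨p, Φ⟩` in `L²_w`, where `y = M⁻¹ (⟨f, Φ⟩ - ⟨f_N, Φ⟩)` (`constrainedProj_eq`,
`wInner_momentRepr`).  It is therefore orthogonal to all elements of `S_N` without moments, and as
`f - f_N` is orthogonal to `S_N`, the theorem of Pythagoras makes `f_N^c` the unique constrained
best approximation.  The quadratic form of `M` is the square norm of the representer, which is
positive since the polynomial with coefficients `y` lies in `S_N` (`constraintMatrix_posDef`).

The square norm of the correction is `bᵀ M⁻¹ b` with `b = ⟨f, Φ⟩ - ⟨f_N, Φ⟩`, which is at most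
`ρ(M⁻¹) ‖b‖²`.  With the two accuracy hypotheses this gives the estimate with the constant
`C₀ + √ρ(M⁻¹) C ‖Φ‖` (`constrainedProj_error_le`).

For Jacobi weights the accuracy of `f_N` has to be proved (`truncationAccuracy_jacobi`).  The
derivatives of Jacobi polynomials are Jacobi polynomials for the weight multiplied by `1 - x²`,
and passing from `f` to `f'` multiplies the energy `⟨f, φ_k⟩² / ‖φ_k‖²` of the mode of degree `k` by
the Sturm–Liouville eigenvalue `k (k + α + β + 1)` (`energy_derivative`).  So the modes of degree
`> N` of `f` carry at most `O(N^{-2r})` times the energy of the `r`-th derivative, by Bessel's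
inequality; they make up all of `f - f_N` because polynomials are dense in `L²_w`.  The factor
`1 - x²` is also what makes the boundary terms vanish when integrating by parts with a weak
derivative (`wInner_jacobi_integration_by_parts`).
-/

namespace ConservativeApprox

open MeasureTheory Polynomial

variable {Ω : Set ℝ} {w f g h : ℝ → ℝ} {φ : ℕ → ℝ[X]}

/-! ### Bilinear form of a weighted `L²` space -/

theorem IsWeight.measurableSet (hw : IsWeight Ω w) : MeasurableSet Ω :=
  hw.interval.measurableSet

theorem IsWeight.interior_ae_eq (hw : IsWeight Ω w) : interior Ω =ᵐ[volume] Ω :=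
  interior_ae_eq_of_null_frontier (hw.interval.convex.addHaar_frontier volume)

theorem IsWeight.restrict_interior (hw : IsWeight Ω w) :
    volume.restrict (interior Ω) = volume.restrict Ω :=
  Measure.restrict_congr_set hw.interior_ae_eq

theorem IsWeight.ae_pos (hw : IsWeight Ω w) : ∀ᵐ x ∂volume.restrict Ω, 0 < w x := by
  rw [← hw.restrict_interior]
  exact (ae_restrict_iff' isOpen_interior.measurableSet).2 (ae_of_all _ hw.pos)

theorem IsWeight.integrable (hw : IsWeight Ω w) : IntegrableOn w Ω := by
  simpa using hw.moments 0

theorem IsWeight.restrict_ne_zero (hw : IsWeight Ω w) : volume.restrict Ω ≠ 0 := by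
  rw [Ne, Measure.restrict_eq_zero]
  intro h0
  exact (isOpen_interior.measure_pos volume hw.nondegenerate).ne'
    (measure_mono_null interior_subset h0)

/-- Lebesgue measure itself is one of the weights, so that the facts about weighted inner products
also apply to the unweighted one. -/
theorem IsWeight.one (hw : IsWeight Ω w) : IsWeight Ω (fun _ => 1) where
  interval := hw.interval
  nondegenerate := hw.nondegenerate
  bounded := hw.bounded
  measurable := by fun_prop
  pos := fun _ _ => one_pos
  moments := fun q => by
    have : IntegrableOn (fun x : ℝ => |x| ^ q * 1) (closure Ω) :=
      ContinuousOn.integrableOn_compact hw.bounded.isCompact_closure (by fun_prop)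
    exact this.mono_set subset_closure

theorem exists_bound_of_continuous (hΩ : Bornology.IsBounded Ω) {p : ℝ → ℝ} (hp : Continuous p) :
    ∃ C, ∀ x ∈ Ω, ‖p x‖ ≤ C := by
  obtain ⟨C, hC⟩ := hΩ.isCompact_closure.exists_bound_of_continuousOn hp.continuousOn
  exact ⟨C, fun x hx => hC x (subset_closure hx)⟩

theorem integrableOn_mul_continuous (hΩ : Bornology.IsBounded Ω) (hm : MeasurableSet Ω)
    (hf : IntegrableOn f Ω) {p : ℝ → ℝ} (hp : Continuous p) :
    IntegrableOn (fun x => f x * p x) Ω := by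
  obtain ⟨C, hC⟩ := exists_bound_of_continuous hΩ hp
  exact Integrable.mul_bdd (c := C) hf hp.aestronglyMeasurable
    ((ae_restrict_iff' hm).2 (ae_of_all _ hC))

theorem continuous_pfun (p : ℝ[X]) : Continuous (pfun p) := p.continuous

theorem memL2_of_continuous (hw : IsWeight Ω w) {p : ℝ → ℝ} (hp : Continuous p) :
    MemL2 Ω w p := by
  refine ⟨hp.aestronglyMeasurable, ?_⟩
  have := integrableOn_mul_continuous hw.bounded hw.measurableSet hw.integrable (hp.pow 2)
  simpa only [mul_comm, Pi.pow_apply] using this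

theorem memL2_pfun (hw : IsWeight Ω w) (p : ℝ[X]) : MemL2 Ω w (pfun p) :=
  memL2_of_continuous hw (continuous_pfun p)

theorem MemL2.integrable_mul (hw : IsWeight Ω w) (hf : MemL2 Ω w f) (hg : MemL2 Ω w g) :
    IntegrableOn (fun x => f x * g x * w x) Ω := by
  refine Integrable.mono' (hf.2.add hg.2)
    ((hf.1.mul hg.1).mul hw.measurable.aestronglyMeasurable) ?_
  filter_upwards [hw.ae_pos] with x hx
  rw [Real.norm_eq_abs, abs_mul, abs_of_pos hx, Pi.add_apply, ← add_mul]
  refine mul_le_mul_of_nonneg_right ?_ hx.le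
  rw [abs_le]
  constructor <;> nlinarith [sq_nonneg (f x + g x), sq_nonneg (f x - g x)]

theorem MemL2.add (hw : IsWeight Ω w) (hf : MemL2 Ω w f) (hg : MemL2 Ω w g) :
    MemL2 Ω w (f + g) := by
  refine ⟨hf.1.add hg.1, ?_⟩
  have := (hf.2.add hg.2).add ((hf.integrable_mul hw hg).const_mul 2)
  refine this.congr (ae_of_all _ fun x => ?_)
  simp only [Pi.add_apply]; ring

theorem MemL2.smul (hf : MemL2 Ω w f) (c : ℝ) : MemL2 Ω w (c • f) := by
  refine ⟨hf.1.const_smul c, ?_⟩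
  refine (hf.2.const_mul (c ^ 2)).congr (ae_of_all _ fun x => ?_)
  simp only [Pi.smul_apply, smul_eq_mul]; ring

theorem MemL2.sub (hw : IsWeight Ω w) (hf : MemL2 Ω w f) (hg : MemL2 Ω w g) :
    MemL2 Ω w (f - g) := by
  have := hf.add hw (hg.smul (-1))
  rwa [neg_one_smul, ← sub_eq_add_neg] at this

theorem wInner_comm (f g : ℝ → ℝ) : wInner Ω w f g = wInner Ω w g f := by
  simp only [wInner, mul_comm (f _)]

theorem wInner_smul_left (c : ℝ) (f g : ℝ → ℝ) : wInner Ω w (c • f) g = c * wInner Ω w f g := by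
  simp only [wInner, ← integral_const_mul, Pi.smul_apply, smul_eq_mul, mul_assoc]

theorem wInner_add_left (hw : IsWeight Ω w) (hf : MemL2 Ω w f) (hg : MemL2 Ω w g)
    (hh : MemL2 Ω w h) : wInner Ω w (f + g) h = wInner Ω w f h + wInner Ω w g h := by
  rw [wInner, wInner, wInner, ← integral_add (hf.integrable_mul hw hh) (hg.integrable_mul hw hh)]
  simp only [Pi.add_apply, add_mul]

theorem wInner_sub_left (hw : IsWeight Ω w) (hf : MemL2 Ω w f) (hg : MemL2 Ω w g)
    (hh : MemL2 Ω w h) : wInner Ω w (f - g) h = wInner Ω w f h - wInner Ω w g h := by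
  rw [wInner, wInner, wInner, ← integral_sub (hf.integrable_mul hw hh) (hg.integrable_mul hw hh)]
  simp only [Pi.sub_apply, sub_mul]

theorem wInner_self_nonneg (hw : IsWeight Ω w) (f : ℝ → ℝ) : 0 ≤ wInner Ω w f f := by
  refine integral_nonneg_of_ae ?_
  filter_upwards [hw.ae_pos] with x hx
  exact mul_nonneg (mul_self_nonneg _) hx.le

theorem wNorm_sq (hw : IsWeight Ω w) (f : ℝ → ℝ) : wNorm Ω w f ^ 2 = wInner Ω w f f :=
  Real.sq_sqrt (wInner_self_nonneg hw f)

theorem wNorm_nonneg (f : ℝ → ℝ) : 0 ≤ wNorm Ω w f := Real.sqrt_nonneg _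

theorem wInner_sub_self (hw : IsWeight Ω w) (hf : MemL2 Ω w f) (hg : MemL2 Ω w g) :
    wInner Ω w (f - g) (f - g) = wInner Ω w f f - 2 * wInner Ω w f g + wInner Ω w g g := by
  rw [wInner_sub_left hw hf hg (hf.sub hw hg), wInner_comm f, wInner_comm g,
    wInner_sub_left hw hf hg hf, wInner_sub_left hw hf hg hg, wInner_comm g f]
  ring

theorem wInner_self_pos (hw : IsWeight Ω w) {p : ℝ[X]} (hp : p ≠ 0) :
    0 < wInner Ω w (pfun p) (pfun p) := by
  refine (wInner_self_nonneg hw _).lt_of_ne' fun h0 => ?_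
  have hnn : 0 ≤ᵐ[volume.restrict Ω] fun x => pfun p x * pfun p x * w x := by
    filter_upwards [hw.ae_pos] with x hx
    exact mul_nonneg (mul_self_nonneg _) hx.le
  have h1 := (integral_eq_zero_iff_of_nonneg_ae hnn
    ((memL2_pfun hw p).integrable_mul hw (memL2_pfun hw p))).1 h0
  have hroots : ∀ᵐ x ∂volume.restrict Ω, x ∉ {x | p.IsRoot x} :=
    ae_restrict_of_ae ((p.finite_setOfPred_isRoot hp).measure_zero volume |> measure_eq_zero_iff_ae_notMem.1)
  have : ∀ᵐ x ∂volume.restrict Ω, False := by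
    filter_upwards [h1, hw.ae_pos, hroots] with x hx hwx hr
    have hr' : pfun p x ≠ 0 := hr
    have : 0 < pfun p x * pfun p x * w x := mul_pos (mul_self_pos.2 hr') hwx
    exact this.ne' hx
  rw [Filter.eventually_false_iff_eq_bot, ae_eq_bot] at this
  exact hw.restrict_ne_zero this

/-! ### Polynomials as functions -/

theorem pfun_add (p q : ℝ[X]) : pfun (p + q) = pfun p + pfun q := by ext; simp [pfun]
theorem pfun_sub (p q : ℝ[X]) : pfun (p - q) = pfun p - pfun q := by ext; simp [pfun]
theorem pfun_smul (c : ℝ) (p : ℝ[X]) : pfun (c • p) = c • pfun p := by ext; simp [pfun]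
theorem pfun_zero : pfun 0 = 0 := by ext; simp [pfun]

theorem pfun_sum {ι : Type*} (s : Finset ι) (c : ι → ℝ) (p : ι → ℝ[X]) :
    pfun (∑ k ∈ s, c k • p k) = fun x => ∑ k ∈ s, c k * pfun (p k) x := by
  ext x; simp [pfun, eval_finsetSum]

theorem wInner_sum_left (hw : IsWeight Ω w) {ι : Type*} (s : Finset ι) (c : ι → ℝ) (p : ι → ℝ[X])
    (hf : MemL2 Ω w f) :
    wInner Ω w (pfun (∑ k ∈ s, c k • p k)) f = ∑ k ∈ s, c k * wInner Ω w (pfun (p k)) f := by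
  classical
  induction s using Finset.induction_on with
  | empty => simp [pfun_zero, wInner]
  | insert a s ha ih =>
    rw [Finset.sum_insert ha, Finset.sum_insert ha, pfun_add,
      wInner_add_left hw (memL2_pfun hw _) (memL2_pfun hw _) hf, pfun_smul, wInner_smul_left, ih]

/-! ### Orthogonal families -/

theorem IsOrthogonalFamily.ne_zero (hφ : IsOrthogonalFamily Ω w φ) (k : ℕ) : φ k ≠ 0 := by
  intro h0
  have := hφ.degree k
  simp [h0] at this

theorem IsOrthogonalFamily.norm_pos (hw : IsWeight Ω w) (hφ : IsOrthogonalFamily Ω w φ) (k : ℕ) :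
    0 < wInner Ω w (pfun (φ k)) (pfun (φ k)) := wInner_self_pos hw (hφ.ne_zero k)

/-- Polynomials `φ 0, …, φ N` of exact degrees `0, …, N` span all polynomials of degree at
most `N`. -/
theorem IsOrthogonalFamily.exists_eq_sum (hφ : IsOrthogonalFamily Ω w φ) {N : ℕ} {p : ℝ[X]}
    (hp : p.degree < (N : ℕ)) : ∃ c : ℕ → ℝ, p = ∑ k ∈ Finset.range N, c k • φ k := by
  let S : Polynomial.Sequence ℝ := ⟨φ, hφ.degree⟩
  have hspan := S.span_degreeLT (m := N) fun i _ =>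
    (leadingCoeff_ne_zero.2 (hφ.ne_zero i)).isUnit
  have : p ∈ Submodule.span ℝ (φ '' Set.Iio N) := by
    have := mem_degreeLT.2 hp
    rw [← hspan] at this
    convert this using 2
  rw [← Finset.coe_range, Submodule.mem_span_image_finset_iff_exists_fun'] at this
  obtain ⟨c, hc⟩ := this
  exact ⟨c, hc.symm⟩

theorem IsOrthogonalFamily.mem_polySpace_iff (hφ : IsOrthogonalFamily Ω w φ) {N : ℕ} :
    g ∈ polySpace φ N ↔ ∃ p : ℝ[X], p.degree < (N + 1 : ℕ) ∧ g = pfun p := by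
  constructor
  · intro hg
    refine Submodule.span_induction ?_ ⟨0, by simp, pfun_zero.symm⟩ ?_ ?_ hg
    · rintro _ ⟨k, hk, rfl⟩
      exact ⟨φ k, by rw [hφ.degree]; exact_mod_cast Nat.lt_succ_of_le hk, rfl⟩
    · rintro _ _ _ _ ⟨p, hp, rfl⟩ ⟨q, hq, rfl⟩
      exact ⟨p + q, (degree_add_le p q).trans_lt (max_lt hp hq), (pfun_add p q).symm⟩
    · rintro c _ _ ⟨p, hp, rfl⟩
      exact ⟨c • p, (degree_smul_le c p).trans_lt hp, (pfun_smul c p).symm⟩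
  · rintro ⟨p, hp, rfl⟩
    obtain ⟨c, rfl⟩ := hφ.exists_eq_sum hp
    have : pfun (∑ k ∈ Finset.range (N + 1), c k • φ k) =
        ∑ k ∈ Finset.range (N + 1), c k • pfun (φ k) := by
      ext x; simp [pfun_sum]
    rw [this]
    exact Submodule.sum_mem _ fun k hk => Submodule.smul_mem _ _ (Submodule.subset_span
      ⟨k, Nat.lt_succ_iff.1 (Finset.mem_range.1 hk), rfl⟩)

theorem IsOrthogonalFamily.wInner_sum (hw : IsWeight Ω w) (hφ : IsOrthogonalFamily Ω w φ)
    (s : Finset ℕ) (c : ℕ → ℝ) {k : ℕ} (hk : k ∈ s) :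
    wInner Ω w (pfun (∑ j ∈ s, c j • φ j)) (pfun (φ k)) =
      c k * wInner Ω w (pfun (φ k)) (pfun (φ k)) := by
  rw [wInner_sum_left hw _ _ _ (memL2_pfun hw _), Finset.sum_eq_single_of_mem k hk]
  intro j _ hj
  rw [hφ.orthogonal j k hj, mul_zero]

/-- `φ k` is orthogonal to all polynomials of smaller degree. -/
theorem IsOrthogonalFamily.wInner_eq_zero (hw : IsWeight Ω w) (hφ : IsOrthogonalFamily Ω w φ)
    {k : ℕ} {p : ℝ[X]} (hp : p.degree < k) : wInner Ω w (pfun p) (pfun (φ k)) = 0 := by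
  obtain ⟨c, rfl⟩ := hφ.exists_eq_sum hp
  rw [wInner_sum_left hw _ _ _ (memL2_pfun hw _)]
  refine Finset.sum_eq_zero fun j hj => ?_
  rw [hφ.orthogonal j k (Finset.mem_range.1 hj).ne, mul_zero]

/-! ### Truncated expansions -/

/-- The truncated expansion as a polynomial. -/
noncomputable def truncPoly (Ω : Set ℝ) (w : ℝ → ℝ) (φ : ℕ → ℝ[X]) (N : ℕ) (f : ℝ → ℝ) : ℝ[X] :=
  ∑ k ∈ Finset.range (N + 1), coeff Ω w φ f k • φ k

theorem truncation_eq (N : ℕ) (f : ℝ → ℝ) :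
    truncation Ω w φ N f = pfun (truncPoly Ω w φ N f) := (pfun_sum _ _ _).symm

theorem IsOrthogonalFamily.degree_sum_lt (hφ : IsOrthogonalFamily Ω w φ) (N : ℕ) (c : ℕ → ℝ) :
    (∑ k ∈ Finset.range N, c k • φ k).degree < N := by
  rw [← mem_degreeLT]
  refine Submodule.sum_mem _ fun k hk => Submodule.smul_mem _ _ (mem_degreeLT.2 ?_)
  rw [hφ.degree]
  exact_mod_cast Finset.mem_range.1 hk

theorem wInner_sub_sum_eq_zero (hw : IsWeight Ω w) (hφ : IsOrthogonalFamily Ω w φ)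
    (hf : MemL2 Ω w f) (s : Finset ℕ) {k : ℕ} (hk : k ∈ s) :
    wInner Ω w (f - pfun (∑ j ∈ s, coeff Ω w φ f j • φ j)) (pfun (φ k)) = 0 := by
  rw [wInner_sub_left hw hf (memL2_pfun hw _) (memL2_pfun hw _), hφ.wInner_sum hw _ _ hk, coeff,
    wNorm_sq hw, div_mul_cancel₀ _ (hφ.norm_pos hw k).ne', sub_self]

/-- `f - f_N` is orthogonal to `S_N`. -/
theorem wInner_sub_truncation (hw : IsWeight Ω w) (hφ : IsOrthogonalFamily Ω w φ)
    (hf : MemL2 Ω w f) {N : ℕ} {p : ℝ[X]} (hp : p.degree < (N + 1 : ℕ)) :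
    wInner Ω w (f - truncation Ω w φ N f) (pfun p) = 0 := by
  obtain ⟨c, rfl⟩ := hφ.exists_eq_sum hp
  have hd : MemL2 Ω w (f - truncation Ω w φ N f) := by
    rw [truncation_eq]; exact hf.sub hw (memL2_pfun hw _)
  rw [wInner_comm, wInner_sum_left hw _ _ _ hd]
  refine Finset.sum_eq_zero fun k hk => ?_
  rw [wInner_comm, truncation_eq, truncPoly, wInner_sub_sum_eq_zero hw hφ hf _ hk, mul_zero]

/-- The share `⟨f, φ_k⟩² / ‖φ_k‖²` of `φ k` in the square norm of `f`. -/
noncomputable def energy (Ω : Set ℝ) (w : ℝ → ℝ) (φ : ℕ → ℝ[X]) (f : ℝ → ℝ) (k : ℕ) : ℝ :=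
  wInner Ω w f (pfun (φ k)) ^ 2 / wInner Ω w (pfun (φ k)) (pfun (φ k))

theorem energy_nonneg (hw : IsWeight Ω w) (k : ℕ) : 0 ≤ energy Ω w φ f k :=
  div_nonneg (sq_nonneg _) (wInner_self_nonneg hw _)

theorem wInner_sub_sum_self (hw : IsWeight Ω w) (hφ : IsOrthogonalFamily Ω w φ)
    (hf : MemL2 Ω w f) (s : Finset ℕ) :
    wInner Ω w (f - pfun (∑ j ∈ s, coeff Ω w φ f j • φ j))
        (f - pfun (∑ j ∈ s, coeff Ω w φ f j • φ j)) =
      wInner Ω w f f - ∑ k ∈ s, energy Ω w φ f k := by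
  have h1 : wInner Ω w f (pfun (∑ j ∈ s, coeff Ω w φ f j • φ j)) =
      ∑ k ∈ s, energy Ω w φ f k := by
    rw [wInner_comm, wInner_sum_left hw _ _ _ hf]
    refine Finset.sum_congr rfl fun k _ => ?_
    rw [wInner_comm, coeff, energy, wNorm_sq hw]; ring
  have h2 : wInner Ω w (pfun (∑ j ∈ s, coeff Ω w φ f j • φ j))
      (pfun (∑ j ∈ s, coeff Ω w φ f j • φ j)) = ∑ k ∈ s, energy Ω w φ f k := by
    rw [wInner_sum_left hw _ _ _ (memL2_pfun hw _)]
    refine Finset.sum_congr rfl fun k hk => ?_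
    rw [wInner_comm, hφ.wInner_sum hw _ _ hk, coeff, energy, wNorm_sq hw]
    have := (hφ.norm_pos hw k).ne'
    field_simp
  rw [wInner_sub_self hw hf (memL2_pfun hw _), h1, h2]; ring

/-- Bessel's inequality. -/
theorem sum_energy_le (hw : IsWeight Ω w) (hφ : IsOrthogonalFamily Ω w φ)
    (hf : MemL2 Ω w f) (s : Finset ℕ) : ∑ k ∈ s, energy Ω w φ f k ≤ wInner Ω w f f := by
  have := wInner_sub_sum_self hw hφ hf s
  have := wInner_self_nonneg hw (f - pfun (∑ j ∈ s, coeff Ω w φ f j • φ j))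
  linarith

theorem wInner_sub_truncation_self (hw : IsWeight Ω w) (hφ : IsOrthogonalFamily Ω w φ)
    (hf : MemL2 Ω w f) (N : ℕ) :
    wInner Ω w (f - truncation Ω w φ N f) (f - truncation Ω w φ N f) =
      wInner Ω w f f - ∑ k ∈ Finset.range (N + 1), energy Ω w φ f k := by
  rw [truncation_eq, truncPoly, wInner_sub_sum_self hw hφ hf]

/-- Pythagoras: `‖f - f_N - p‖² = ‖f - f_N‖² + ‖p‖²` for `p` in `S_N`. -/
theorem wInner_sub_truncation_sub (hw : IsWeight Ω w) (hφ : IsOrthogonalFamily Ω w φ)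
    (hf : MemL2 Ω w f) {N : ℕ} {p : ℝ[X]} (hp : p.degree < (N + 1 : ℕ)) :
    wInner Ω w (f - truncation Ω w φ N f - pfun p) (f - truncation Ω w φ N f - pfun p) =
      wInner Ω w (f - truncation Ω w φ N f) (f - truncation Ω w φ N f) +
        wInner Ω w (pfun p) (pfun p) := by
  have hd : MemL2 Ω w (f - truncation Ω w φ N f) := by
    rw [truncation_eq]; exact hf.sub hw (memL2_pfun hw _)
  rw [wInner_sub_self hw hd (memL2_pfun hw _), wInner_sub_truncation hw hφ hf hp]; ring

/-! ### Moments and the constraint matrix -/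

theorem momentVec_apply (Q : ℕ) (g : ℝ → ℝ) (q : Fin (Q + 1)) :
    momentVec Ω Q g q = wInner Ω (fun _ => 1) g (pfun (X ^ (q : ℕ))) := by
  simp [momentVec, wInner, pfun]

theorem momentVec_add_pfun (hw : IsWeight Ω w) (Q : ℕ) (p q : ℝ[X]) :
    momentVec Ω Q (pfun (p + q)) = momentVec Ω Q (pfun p) + momentVec Ω Q (pfun q) := by
  ext i
  simp only [momentVec_apply, PiLp.add_apply, pfun_add]
  exact wInner_add_left hw.one (memL2_pfun hw.one _) (memL2_pfun hw.one _) (memL2_pfun hw.one _)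

theorem momentVec_sum (hw : IsWeight Ω w) (Q : ℕ) (s : Finset ℕ) (c : ℕ → ℝ) (q : Fin (Q + 1)) :
    momentVec Ω Q (pfun (∑ k ∈ s, c k • φ k)) q = ∑ k ∈ s, c k * phiHat Ω φ Q k q := by
  rw [momentVec_apply, wInner_sum_left hw.one _ _ _ (memL2_pfun hw.one _)]
  simp only [phiHat, momentVec_apply]

/-- The element of `S_N` that represents the functional `p ↦ y · ⟨p, Φ⟩` in `L²_w`. -/
noncomputable def momentRepr (Ω : Set ℝ) (w : ℝ → ℝ) (φ : ℕ → ℝ[X]) (Q N : ℕ)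
    (y : Fin (Q + 1) → ℝ) : ℝ[X] :=
  ∑ k ∈ Finset.range (N + 1), (1 / wNorm Ω w (pfun (φ k)) ^ 2 * (phiHat Ω φ Q k ⬝ᵥ y)) • φ k

theorem wInner_momentRepr (hw : IsWeight Ω w) (hφ : IsOrthogonalFamily Ω w φ) {Q N : ℕ}
    (y : Fin (Q + 1) → ℝ) {p : ℝ[X]} (hp : p.degree < (N + 1 : ℕ)) :
    wInner Ω w (pfun (momentRepr Ω w φ Q N y)) (pfun p) = y ⬝ᵥ momentVec Ω Q (pfun p) := by
  obtain ⟨c, rfl⟩ := hφ.exists_eq_sum hp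
  rw [momentRepr, wInner_sum_left hw _ _ _ (memL2_pfun hw _)]
  simp only [dotProduct, momentVec_sum hw, Finset.mul_sum]
  rw [Finset.sum_comm]
  refine Finset.sum_congr rfl fun k hk => ?_
  rw [wInner_comm, hφ.wInner_sum hw _ _ hk, wNorm_sq hw, Finset.sum_mul]
  refine Finset.sum_congr rfl fun q _ => ?_
  have := (hφ.norm_pos hw k).ne'
  field_simp

theorem momentVec_momentRepr (hw : IsWeight Ω w) (Q N : ℕ) (y : Fin (Q + 1) → ℝ) :
    (momentVec Ω Q (pfun (momentRepr Ω w φ Q N y)) : Fin (Q + 1) → ℝ) =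
      (constraintMatrix Ω w φ Q N).mulVec y := by
  ext q
  rw [momentRepr, momentVec_sum hw, constraintMatrix, Matrix.sum_mulVec, Finset.sum_apply]
  refine Finset.sum_congr rfl fun k _ => ?_
  rw [Matrix.smul_mulVec, Matrix.vecMulVec_mulVec]
  simp only [Pi.smul_apply, smul_eq_mul, MulOpposite.smul_eq_mul_unop, MulOpposite.unop_op]
  ring

theorem IsOrthogonalFamily.degree_momentRepr (hφ : IsOrthogonalFamily Ω w φ) (Q N : ℕ)
    (y : Fin (Q + 1) → ℝ) : (momentRepr Ω w φ Q N y).degree < (N + 1 : ℕ) :=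
  hφ.degree_sum_lt _ _

theorem dotProduct_constraintMatrix_mulVec (hw : IsWeight Ω w) (hφ : IsOrthogonalFamily Ω w φ)
    (Q N : ℕ) (y : Fin (Q + 1) → ℝ) :
    y ⬝ᵥ (constraintMatrix Ω w φ Q N).mulVec y =
      wInner Ω w (pfun (momentRepr Ω w φ Q N y)) (pfun (momentRepr Ω w φ Q N y)) := by
  rw [wInner_momentRepr hw hφ y (hφ.degree_momentRepr Q N y), momentVec_momentRepr hw]

/-- The quadratic form of `M` is the square norm of the representer of `p ↦ y · ⟨p, Φ⟩`.  As
`N ≥ Q`, it vanishes only if the polynomial with coefficients `y` is orthogonal to itself for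
Lebesgue measure. -/
theorem constraintMatrix_posDef (hw : IsWeight Ω w) (hφ : IsOrthogonalFamily Ω w φ) {Q N : ℕ}
    (hQN : Q ≤ N) : (constraintMatrix Ω w φ Q N).PosDef := by
  refine Matrix.PosDef.of_dotProduct_mulVec_pos ?_ fun y hy => ?_
  · ext i j
    simp only [constraintMatrix, Matrix.conjTranspose_apply, Matrix.sum_apply, Matrix.smul_apply,
      Matrix.vecMulVec_apply, star_trivial, smul_eq_mul]
    exact Finset.sum_congr rfl fun k _ => by ring
  · rw [star_trivial, dotProduct_constraintMatrix_mulVec hw hφ]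
    refine wInner_self_pos hw fun h0 => hy ?_
    set p : ℝ[X] := ∑ q : Fin (Q + 1), y q • X ^ (q : ℕ) with hp
    have hdeg : p.degree < (N + 1 : ℕ) := by
      rw [← mem_degreeLT]
      refine Submodule.sum_mem _ fun q _ => Submodule.smul_mem _ _ (mem_degreeLT.2 ?_)
      rw [degree_X_pow]
      exact_mod_cast q.2.trans_le (Nat.succ_le_succ hQN)
    have h1 : wInner Ω (fun _ => 1) (pfun p) (pfun p) = 0 := by
      rw [hp, wInner_sum_left hw.one _ _ _ (memL2_pfun hw.one _), ← hp]
      have h2 := wInner_momentRepr hw hφ y hdeg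
      rw [h0, pfun_zero] at h2
      simp only [dotProduct, momentVec_apply] at h2
      rw [← (show wInner Ω w 0 (pfun p) = 0 by simp [wInner]), h2]
      exact Finset.sum_congr rfl fun q _ => by rw [wInner_comm]
    have hp0 : p = 0 := by
      by_contra hne
      exact (wInner_self_pos hw.one hne).ne' h1
    ext i
    have := congrArg (fun r : ℝ[X] => r.coeff i) hp0
    simpa [hp, finsetSum_coeff, coeff_X_pow, Fin.val_inj] using this

theorem constrainedProj_eq (N Q : ℕ) (f : ℝ → ℝ) :
    constrainedProj Ω w φ Q N f = truncation Ω w φ N f + pfun (momentRepr Ω w φ Q N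
      ((constraintMatrix Ω w φ Q N)⁻¹.mulVec
        (momentVec Ω Q f - momentVec Ω Q (truncation Ω w φ N f) : Fin (Q + 1) → ℝ))) := by
  rw [momentRepr, pfun_sum]
  ext x
  simp only [constrainedProj, truncation, constrainedCoeff, Pi.add_apply, add_mul,
    Finset.sum_add_distrib]
  congr 1
  refine Finset.sum_congr rfl fun k _ => ?_
  rw [Matrix.dotProduct_mulVec, dotProduct, Finset.mul_sum]
  congr 1
  refine Finset.sum_congr rfl fun q _ => ?_
  simp only [cHat, Pi.smul_apply, smul_eq_mul, Pi.sub_apply, mul_assoc]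

/-! ### The constrained projection as a best approximation -/

theorem momentVec_constrainedProj (hw : IsWeight Ω w) (hφ : IsOrthogonalFamily Ω w φ) {Q N : ℕ}
    (hQN : Q ≤ N) (f : ℝ → ℝ) :
    momentVec Ω Q (constrainedProj Ω w φ Q N f) = momentVec Ω Q f := by
  have hdet := (constraintMatrix_posDef hw hφ hQN).isUnit
  rw [constrainedProj_eq, truncation_eq, ← pfun_add, momentVec_add_pfun hw]
  ext q
  rw [PiLp.add_apply, momentVec_momentRepr hw, Matrix.mulVec_mulVec,
    Matrix.mul_nonsing_inv _ ((Matrix.isUnit_iff_isUnit_det _).1 hdet), Matrix.one_mulVec]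
  simp

theorem constrainedProj_isConstrainedBestApprox (hw : IsWeight Ω w)
    (hφ : IsOrthogonalFamily Ω w φ) {Q N : ℕ} (hQN : Q ≤ N) (hf : MemL2 Ω w f) :
    IsConstrainedBestApprox Ω w φ Q N f (constrainedProj Ω w φ Q N f) := by
  have hmom := momentVec_constrainedProj hw hφ hQN f
  rw [constrainedProj_eq] at hmom ⊢
  set y := (constraintMatrix Ω w φ Q N)⁻¹.mulVec
        (momentVec Ω Q f - momentVec Ω Q (truncation Ω w φ N f) : Fin (Q + 1) → ℝ)
  set d := momentRepr Ω w φ Q N y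
  have hd : d.degree < (N + 1 : ℕ) := hφ.degree_momentRepr Q N y
  have ht : (truncPoly Ω w φ N f).degree < (N + 1 : ℕ) := hφ.degree_sum_lt _ _
  refine ⟨hφ.mem_polySpace_iff.2 ⟨_, (degree_add_le _ _).trans_lt (max_lt ht hd), ?_⟩, hmom, ?_⟩
  · rw [truncation_eq, pfun_add]
  intro g' hg' hmom' hne
  obtain ⟨p, hp, rfl⟩ := hφ.mem_polySpace_iff.1 hg'
  set u := p - truncPoly Ω w φ N f - d with hu
  have hpd : (p - truncPoly Ω w φ N f).degree < (N + 1 : ℕ) :=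
    (degree_sub_le _ _).trans_lt (max_lt hp ht)
  have hud : u.degree < (N + 1 : ℕ) := (degree_sub_le _ _).trans_lt (max_lt hpd hd)
  have hpu : p = truncPoly Ω w φ N f + d + u := by rw [hu]; ring
  have hu0 : u ≠ 0 := by
    intro h0
    rw [h0, add_zero] at hpu
    exact hne (by rw [hpu, pfun_add, truncation_eq])
  have hmu : momentVec Ω Q (pfun u) = 0 := by
    rw [hpu, momentVec_add_pfun hw, ← hmom, truncation_eq, ← pfun_add] at hmom'
    simpa using hmom'
  -- A competitor differs from `f_N^c` by a polynomial without moments, hence orthogonal to `d`.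
  have horth : wInner Ω w (pfun d) (pfun u) = 0 := by
    rw [wInner_momentRepr hw hφ y hud, hmu]; simp [dotProduct]
  refine Real.sqrt_lt_sqrt (wInner_self_nonneg hw _) ?_
  have e1 : f - (truncation Ω w φ N f + pfun d) = f - truncation Ω w φ N f - pfun d := by abel
  have e2 : f - pfun p = f - truncation Ω w φ N f - pfun (d + u) := by
    rw [hpu, truncation_eq, pfun_add, pfun_add, pfun_add]; abel
  rw [e1, e2, wInner_sub_truncation_sub hw hφ hf hd, wInner_sub_truncation_sub hw hφ hf
    ((degree_add_le _ _).trans_lt (max_lt hd hud))]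
  have e3 : wInner Ω w (pfun (d + u)) (pfun (d + u)) =
      wInner Ω w (pfun d) (pfun d) + wInner Ω w (pfun u) (pfun u) := by
    have m : ∀ q : ℝ[X], MemL2 Ω w (pfun q) := memL2_pfun hw
    rw [pfun_add, wInner_add_left hw (m d) (m u) ((m d).add hw (m u)), wInner_comm (pfun d),
      wInner_comm (pfun u), wInner_add_left hw (m d) (m u) (m d),
      wInner_add_left hw (m d) (m u) (m u), wInner_comm (pfun u) (pfun d), horth]
    ring
  linarith [wInner_self_pos hw hu0]

/-! ### Error estimate for general weights -/

open scoped MatrixOrder in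
/-- The Rayleigh quotient of a symmetric matrix is at most its spectral radius. -/
theorem dotProduct_mulVec_le_spectralRadius {n : Type*} [Fintype n] [DecidableEq n]
    {A : Matrix n n ℝ} (hA : A.IsHermitian) (b : n → ℝ) :
    b ⬝ᵥ A.mulVec b ≤ (spectralRadius ℝ A).toReal * (b ⬝ᵥ b) := by
  have hfin : spectralRadius ℝ A ≠ ⊤ := by
    have h0 : spectralRadius ℝ A = ⨆ k : spectrum ℝ A, (‖(k : ℝ)‖₊ : ENNReal) := by
      rw [spectralRadius, iSup_subtype]
    have := A.finite_real_spectrum.to_subtype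
    rw [h0]
    cases isEmpty_or_nonempty (spectrum ℝ A)
    · simp
    · obtain ⟨k, hk⟩ := exists_eq_ciSup_of_finite (f := fun k : spectrum ℝ A =>
        (‖(k : ℝ)‖₊ : ENNReal))
      rw [← hk]; exact ENNReal.coe_ne_top
  have hle : ∀ μ ∈ spectrum ℝ A, μ ≤ (spectralRadius ℝ A).toReal := fun μ hμ => by
    have h1 : (‖μ‖₊ : ENNReal) ≤ spectralRadius ℝ A :=
      le_iSup₂ (f := fun k (_ : k ∈ spectrum ℝ A) => (‖k‖₊ : ENNReal)) μ hμ
    have h2 := ENNReal.toReal_mono hfin h1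
    rw [ENNReal.coe_toReal, coe_nnnorm] at h2
    exact (Real.le_norm_self μ).trans h2
  have h := (le_algebraMap_iff_spectrum_le (r := (spectralRadius ℝ A).toReal) (a := A) hA).2 hle
  have h' := (Matrix.le_iff.1 h).dotProduct_mulVec_nonneg b
  rw [Matrix.sub_mulVec, dotProduct_sub, star_trivial, Algebra.algebraMap_eq_smul_one,
    Matrix.smul_mulVec, Matrix.one_mulVec, dotProduct_smul, smul_eq_mul] at h'
  linarith

theorem wInner_constrainedProj_error (hw : IsWeight Ω w) (hφ : IsOrthogonalFamily Ω w φ) {Q N : ℕ}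
    (hQN : Q ≤ N) (hf : MemL2 Ω w f) :
    wNorm Ω w (f - constrainedProj Ω w φ Q N f) ^ 2 ≤
      wNorm Ω w (f - truncation Ω w φ N f) ^ 2 + invSpectralRadius Ω w φ Q N *
        ‖momentVec Ω Q f - momentVec Ω Q (truncation Ω w φ N f)‖ ^ 2 := by
  have hM := constraintMatrix_posDef hw hφ hQN
  rw [wNorm_sq hw, wNorm_sq hw, constrainedProj_eq, ← sub_sub,
    wInner_sub_truncation_sub hw hφ hf (hφ.degree_momentRepr _ _ _),
    ← dotProduct_constraintMatrix_mulVec hw hφ, Matrix.mulVec_mulVec,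
    Matrix.mul_nonsing_inv _ ((Matrix.isUnit_iff_isUnit_det _).1 hM.isUnit), Matrix.one_mulVec,
    dotProduct_comm]
  refine add_le_add_right ((dotProduct_mulVec_le_spectralRadius hM.inv.isHermitian _).trans_eq ?_) _
  rw [invSpectralRadius, EuclideanSpace.real_norm_sq_eq, dotProduct]
  simp only [pow_two, PiLp.sub_apply, Pi.sub_apply]

theorem wNorm_constrainedProj_error (hw : IsWeight Ω w) (hφ : IsOrthogonalFamily Ω w φ) {Q N : ℕ}
    (hQN : Q ≤ N) (hf : MemL2 Ω w f) :
    wNorm Ω w (f - constrainedProj Ω w φ Q N f) ≤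
      wNorm Ω w (f - truncation Ω w φ N f) + √(invSpectralRadius Ω w φ Q N) *
        ‖momentVec Ω Q f - momentVec Ω Q (truncation Ω w φ N f)‖ := by
  have h := wInner_constrainedProj_error hw hφ hQN hf
  have hr : √(invSpectralRadius Ω w φ Q N) ^ 2 = invSpectralRadius Ω w φ Q N :=
    Real.sq_sqrt ENNReal.toReal_nonneg
  have h1 := wNorm_nonneg (Ω := Ω) (w := w) (f - truncation Ω w φ N f)
  have h2 := mul_nonneg (Real.sqrt_nonneg (invSpectralRadius Ω w φ Q N))
    (norm_nonneg (momentVec Ω Q f - momentVec Ω Q (truncation Ω w φ N f)))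
  refine le_of_sq_le_sq (h.trans ?_) (by positivity)
  rw [add_sq, mul_pow, hr]
  linarith [mul_nonneg h1 h2]

/-- The constant of the error estimate, for the constants `C₀` of the truncated expansion and `C`
of the moments. -/
noncomputable def errorConst (C₀ C ρ s : ℝ) : ℝ := C₀ + √ρ * (C * max s 0)

theorem monotone_errorConst (C₀ : ℝ) {C : ℝ} (hC : 0 < C) :
    Monotone (Function.uncurry (errorConst C₀ C)) := by
  rintro ⟨ρ, s⟩ ⟨ρ', s'⟩ ⟨h1, h2⟩
  simp only [Function.uncurry, errorConst]
  have := Real.sqrt_le_sqrt h1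
  have := max_le_max_right 0 h2
  gcongr

theorem constrainedProj_error_le (hw : IsWeight Ω w) (hφ : IsOrthogonalFamily Ω w φ)
    {C₀ C : ℝ} {r Q N : ℕ} (hQN : Q ≤ N) (hf : MemL2 Ω w f)
    (ht : TruncationAccuracy Ω w φ r N C₀ f) (hm : MomentAccuracy Ω w φ r Q N C f) :
    wNorm Ω w (f - constrainedProj Ω w φ Q N f) ≤
      errorConst C₀ C (invSpectralRadius Ω w φ Q N) (phiNorm Ω w Q) / (N : ℝ) ^ r *
        sobolevNorm Ω w r f := by
  refine (wNorm_constrainedProj_error hw hφ hQN hf).trans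
    ((add_le_add ht (mul_le_mul_of_nonneg_left hm (Real.sqrt_nonneg _))).trans_eq ?_)
  rw [errorConst, max_eq_left (show 0 ≤ phiNorm Ω w Q from Real.sqrt_nonneg _)]
  ring

/-! ### Density of the polynomials -/

theorem wInner_self_add_le (hw : IsWeight Ω w) (hf : MemL2 Ω w f) (hg : MemL2 Ω w g) :
    wInner Ω w (f + g) (f + g) ≤ 2 * wInner Ω w f f + 2 * wInner Ω w g g := by
  have h := wInner_self_nonneg hw (f - g)
  rw [wInner_sub_self hw hf hg] at h
  rw [wInner_add_left hw hf hg (hf.add hw hg), wInner_comm f, wInner_comm g,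
    wInner_add_left hw hf hg hf, wInner_add_left hw hf hg hg, wInner_comm g f]
  linarith

/-- Polynomials are dense in `L²_w(Ω)`: continuous functions are, and on the bounded set `Ω` these
are uniform limits of polynomials. -/
theorem exists_polynomial_wInner_sub_le (hw : IsWeight Ω w) (hf : MemL2 Ω w f) {ε : ℝ}
    (hε : 0 < ε) : ∃ p : ℝ[X], wInner Ω w (f - pfun p) (f - pfun p) ≤ ε := by
  set d : ℝ → ENNReal := fun x => ENNReal.ofReal (w x)
  set μ := (volume.restrict Ω).withDensity d with hμ
  have hd : AEMeasurable d (volume.restrict Ω) := hw.measurable.ennreal_ofReal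
  have hlt : ∀ᵐ x ∂volume.restrict Ω, d x < ⊤ := ae_of_all _ fun _ => ENNReal.ofReal_lt_top
  have hae : ∀ᵐ x ∂volume.restrict Ω, (d x).toReal = w x := by
    filter_upwards [hw.ae_pos] with x hx using ENNReal.toReal_ofReal hx.le
  have : IsFiniteMeasure μ := isFiniteMeasure_withDensity_ofReal hw.integrable.2
  have hfm : AEStronglyMeasurable f μ := hf.1.mono_ac (withDensity_absolutelyContinuous _ _)
  have hfL : MemLp f (ENNReal.ofReal 2) μ := by
    rw [ENNReal.ofReal_ofNat, memLp_two_iff_integrable_sq hfm, hμ,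
      integrable_withDensity_iff_integrable_smul₀' hd hlt]
    refine hf.2.congr ?_
    filter_upwards [hae] with x hx
    rw [hx, smul_eq_mul, mul_comm]
  obtain ⟨g, -, hfg, hgc, -⟩ := hfL.exists_hasCompactSupport_integral_rpow_sub_le two_pos
    (show 0 < ε / 4 by positivity)
  have hgL := memL2_of_continuous hw hgc
  have hfg' : wInner Ω w (f - g) (f - g) ≤ ε / 4 := by
    rw [hμ, integral_withDensity_eq_integral_toReal_smul₀ hd hlt] at hfg
    refine le_of_eq_of_le (integral_congr_ae ?_) hfg
    filter_upwards [hae] with x hx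
    rw [hx, smul_eq_mul, Real.rpow_two, Real.norm_eq_abs, sq_abs, Pi.sub_apply]
    ring
  set I := ∫ x in Ω, w x
  have hI : 0 ≤ I := integral_nonneg_of_ae (by filter_upwards [hw.ae_pos] with x hx using hx.le)
  obtain ⟨R, hR⟩ := hw.bounded.subset_closedBall 0
  rw [Real.closedBall_eq_Icc] at hR
  set δ := √(ε / (4 * (I + 1)))
  have hδ : 0 < δ := Real.sqrt_pos.2 (by positivity)
  obtain ⟨p, hp⟩ := exists_polynomial_near_of_continuousOn _ _ g hgc.continuousOn δ hδ
  have hgp : wInner Ω w (g - pfun p) (g - pfun p) ≤ ε / 4 := by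
    have h1 : wInner Ω w (g - pfun p) (g - pfun p) ≤ ∫ x in Ω, δ ^ 2 * w x := by
      have hgpL := hgL.sub hw (memL2_pfun hw p)
      refine integral_mono_ae (hgpL.integrable_mul hw hgpL) (hw.integrable.const_mul _) ?_
      filter_upwards [hw.ae_pos, ae_restrict_mem hw.measurableSet] with x hx hxΩ
      refine mul_le_mul_of_nonneg_right ?_ hx.le
      rw [← pow_two, Pi.sub_apply]
      have := (hp x (hR hxΩ)).le
      rw [abs_sub_comm] at this
      exact sq_le_sq' (abs_le.1 this).1 (abs_le.1 this).2
    rw [integral_const_mul, Real.sq_sqrt (by positivity)] at h1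
    refine h1.trans ?_
    rw [div_mul_eq_mul_div, div_le_div_iff₀ (by positivity) (by positivity)]
    nlinarith
  refine ⟨p, ?_⟩
  have h := wInner_self_add_le hw (hf.sub hw hgL) (hgL.sub hw (memL2_pfun hw p))
  rw [sub_add_sub_cancel] at h
  linarith

/-- `f_N` is the best approximation to `f` in `S_N`. -/
theorem wInner_sub_truncation_le (hw : IsWeight Ω w) (hφ : IsOrthogonalFamily Ω w φ)
    (hf : MemL2 Ω w f) {N : ℕ} {p : ℝ[X]} (hp : p.degree < (N + 1 : ℕ)) :
    wInner Ω w (f - truncation Ω w φ N f) (f - truncation Ω w φ N f) ≤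
      wInner Ω w (f - pfun p) (f - pfun p) := by
  have ht : (truncPoly Ω w φ N f).degree < (N + 1 : ℕ) := hφ.degree_sum_lt _ _
  have h := wInner_sub_truncation_sub hw hφ hf ((degree_sub_le p _).trans_lt (max_lt hp ht))
  have e : f - truncation Ω w φ N f - pfun (p - truncPoly Ω w φ N f) = f - pfun p := by
    rw [pfun_sub, truncation_eq]; abel
  rw [e] at h
  rw [h]
  exact le_add_of_nonneg_right (wInner_self_nonneg hw _)

/-- The part of Parseval's identity that bounds the error of `f_N` by the energies of the
neglected modes. -/
theorem wInner_sub_truncation_le_of_sum_energy_le (hw : IsWeight Ω w)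
    (hφ : IsOrthogonalFamily Ω w φ) (hf : MemL2 Ω w f) {N : ℕ} {B : ℝ}
    (hB : ∀ K, ∑ k ∈ Finset.Ico (N + 1) K, energy Ω w φ f k ≤ B) :
    wInner Ω w (f - truncation Ω w φ N f) (f - truncation Ω w φ N f) ≤ B := by
  refine le_of_forall_pos_le_add fun ε hε => ?_
  obtain ⟨p, hp⟩ := exists_polynomial_wInner_sub_le hw hf hε
  have hpd : p.degree < ((max N p.natDegree + 1 : ℕ)) := by
    refine degree_le_natDegree.trans_lt ?_
    exact_mod_cast Nat.lt_succ_of_le (le_max_right _ _)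
  have h1 := (wInner_sub_truncation_le hw hφ hf hpd).trans hp
  rw [wInner_sub_truncation_self hw hφ hf] at h1 ⊢
  have h2 := Finset.sum_range_add_sum_Ico (energy Ω w φ f)
    (Nat.succ_le_succ (le_max_left N p.natDegree))
  have h3 := hB (max N p.natDegree + 1)
  simp only [Nat.succ_eq_add_one] at h2
  linarith

/-! ### Weak derivatives -/

theorem wInner_congr_ae {f₁ f₂ : ℝ → ℝ} (h : f₁ =ᵐ[volume.restrict Ω] f₂) (g : ℝ → ℝ) :
    wInner Ω w f₁ g = wInner Ω w f₂ g :=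
  integral_congr_ae (by filter_upwards [h] with x hx; rw [hx])

theorem MemL2.congr_ae (hf : MemL2 Ω w f) (h : f =ᵐ[volume.restrict Ω] g) : MemL2 Ω w g :=
  ⟨hf.1.congr h, hf.2.congr (by filter_upwards [h] with x hx; rw [hx])⟩

theorem IsWeakDeriv.ae_eq {U : Set ℝ} (hU : IsOpen U) {j : ℕ} {g₁ g₂ : ℝ → ℝ}
    (h₁ : IsWeakDeriv U j f g₁) (h₂ : IsWeakDeriv U j f g₂) : g₁ =ᵐ[volume.restrict U] g₂ := by
  have key := hU.ae_eq_zero_of_integral_contDiff_smul_eq_zero (μ := volume)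
    (h₁.2.1.sub h₂.2.1) fun ψ hψ hc hs => by
    have e₁ := h₁.2.2 ψ hψ hc hs
    rw [h₂.2.2 ψ hψ hc hs] at e₁
    have e₂ := mul_left_cancel₀ (pow_ne_zero j (by norm_num)) e₁
    have hz : ∀ x, x ∉ U → ψ x • (g₁ - g₂) x = 0 := fun x hx => by
      rw [image_eq_zero_of_notMem_tsupport fun h => hx (hs h), zero_smul]
    rw [← setIntegral_eq_integral_of_forall_compl_eq_zero hz]
    have hi : ∀ g, LocallyIntegrableOn g U → IntegrableOn (fun x => g x * ψ x) U := fun g hg => by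
      have h1 : IntegrableOn (fun x => g x * ψ x) (tsupport ψ) :=
        (hg.integrableOn_compact_subset hs hc).mul_continuousOn hψ.continuous.continuousOn hc
      have h2 : Integrable (fun x => g x * ψ x) := by
        refine (integrableOn_iff_integrable_of_support_subset ?_).1 h1
        exact (Function.support_mul_subset_right _ _).trans (subset_tsupport _)
      exact h2.integrableOn
    have := integral_sub (hi g₁ h₁.2.1) (hi g₂ h₂.2.1)
    rw [e₂, sub_self] at this
    rw [← this]
    refine integral_congr_ae (ae_of_all _ fun x => ?_)
    simp only [Pi.sub_apply, smul_eq_mul]; ring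
  refine ((ae_restrict_iff' hU.measurableSet).2 key).mono fun x hx => ?_
  simpa [sub_eq_zero] using hx

theorem IsWeakDeriv.step {U : Set ℝ} {j : ℕ} {g g' : ℝ → ℝ}
    (h : IsWeakDeriv U j f g) (h' : IsWeakDeriv U (j + 1) f g') : IsWeakDeriv U 1 g g' := by
  refine ⟨h.2.1, h'.2.1, fun ψ hψ hc hs => ?_⟩
  have e := h'.2.2 ψ hψ hc hs
  rw [iteratedDeriv_succ', h.2.2 (deriv ψ) hψ.deriv' hc.deriv
    (tsupport_deriv_subset.trans hs), pow_succ, mul_assoc] at e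
  rw [iteratedDeriv_one, pow_one]
  exact mul_left_cancel₀ (pow_ne_zero j (by norm_num)) e

theorem IsWeakDeriv.zero {U : Set ℝ} (hf : LocallyIntegrableOn f U) : IsWeakDeriv U 0 f f :=
  ⟨hf, hf, fun ψ _ _ _ => by simp⟩

theorem isWeakDeriv_pfun {U : Set ℝ} (p : ℝ[X]) :
    IsWeakDeriv U 1 (pfun p) (pfun p.derivative) := by
  have hl : ∀ q : ℝ[X], LocallyIntegrableOn (pfun q) U := fun q =>
    (continuous_pfun q).locallyIntegrable.locallyIntegrableOn U
  refine ⟨hl _, hl _, fun ψ hψ hc hs => ?_⟩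
  have hz : ∀ x, x ∉ U → ψ x = 0 := fun x hx =>
    image_eq_zero_of_notMem_tsupport fun h => hx (hs h)
  have hz' : ∀ x, x ∉ U → deriv ψ x = 0 := fun x hx =>
    image_eq_zero_of_notMem_tsupport fun h => hx (hs (tsupport_deriv_subset h))
  have hcd : Continuous (deriv ψ) := hψ.continuous_deriv (by simp)
  rw [iteratedDeriv_one, setIntegral_eq_integral_of_forall_compl_eq_zero
      fun x hx => by rw [hz' x hx, mul_zero],
    setIntegral_eq_integral_of_forall_compl_eq_zero fun x hx => by rw [hz x hx, mul_zero],
    integral_mul_deriv_eq_deriv_mul_of_integrable (v := ψ) (u' := pfun p.derivative)]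
  · simp
  · exact fun x _ => p.hasDerivAt x
  · exact fun x _ => (hψ.differentiable (by simp) x).hasDerivAt
  · exact ((continuous_pfun p).mul hcd).integrable_of_hasCompactSupport hc.deriv.mul_left
  · exact ((continuous_pfun _).mul hψ.continuous).integrable_of_hasCompactSupport hc.mul_left
  · exact ((continuous_pfun p).mul hψ.continuous).integrable_of_hasCompactSupport hc.mul_left

theorem MemSobolev.isWeakDeriv {r : ℕ} (hf : MemSobolev Ω w r f) {j : ℕ} (hj : j ≤ r) :
    IsWeakDeriv (interior Ω) j f (weakDeriv (interior Ω) j f) := by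
  have h : ∃ g, IsWeakDeriv (interior Ω) j f g := (hf.2 j hj).imp fun _ h => h.1
  rw [weakDeriv, dif_pos h]
  exact Classical.choose_spec h

theorem MemSobolev.memL2_weakDeriv (hw : IsWeight Ω w) {r : ℕ} (hf : MemSobolev Ω w r f) {j : ℕ}
    (hj : j ≤ r) : MemL2 Ω w (weakDeriv (interior Ω) j f) := by
  obtain ⟨g, hg, hg2⟩ := hf.2 j hj
  have h := hg.ae_eq isOpen_interior (hf.isWeakDeriv hj)
  rw [hw.restrict_interior] at h
  exact hg2.congr_ae h

theorem MemSobolev.weakDeriv_zero (hw : IsWeight Ω w) {r : ℕ} (hf : MemSobolev Ω w r f) :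
    f =ᵐ[volume.restrict Ω] weakDeriv (interior Ω) 0 f := by
  have h := hf.isWeakDeriv (Nat.zero_le r)
  have := (IsWeakDeriv.zero h.1).ae_eq isOpen_interior h
  rwa [hw.restrict_interior] at this

theorem wNorm_weakDeriv_le_sobolevNorm {r j : ℕ} (hj : j ≤ r) :
    wNorm Ω w (weakDeriv (interior Ω) j f) ≤ sobolevNorm Ω w r f := by
  refine Real.le_sqrt_of_sq_le ?_
  exact Finset.single_le_sum (f := fun j => wNorm Ω w (weakDeriv (interior Ω) j f) ^ 2)
    (fun _ _ => sq_nonneg _) (Finset.mem_range.2 (Nat.lt_succ_of_le hj))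

/-! ### Jacobi weights -/

theorem jacobiWeight_pos (a b : ℝ) {x : ℝ} (hx : x ∈ Set.Ioo (-1 : ℝ) 1) :
    0 < jacobiWeight a b x :=
  mul_pos (Real.rpow_pos_of_pos (by linarith [hx.2]) _) (Real.rpow_pos_of_pos (by linarith [hx.1]) _)

theorem jacobiWeight_succ (a b : ℝ) {x : ℝ} (hx : x ∈ Set.Ioo (-1 : ℝ) 1) :
    jacobiWeight (a + 1) (b + 1) x = (1 - x ^ 2) * jacobiWeight a b x := by
  have h1 : 1 - x ≠ 0 := by linarith [hx.2]
  have h2 : 1 + x ≠ 0 := by linarith [hx.1]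
  rw [jacobiWeight, jacobiWeight, Real.rpow_add_one h1, Real.rpow_add_one h2]; ring

theorem measurable_jacobiWeight (a b : ℝ) : Measurable (jacobiWeight a b) := by
  unfold jacobiWeight; fun_prop

theorem intervalIntegrable_jacobiWeight_left (a : ℝ) {b : ℝ} (hb : -1 < b) :
    IntervalIntegrable (jacobiWeight a b) volume (-1) 0 := by
  have h := (intervalIntegral.intervalIntegrable_rpow' (a := 0) (b := 1) hb).comp_add_left 1
  norm_num at h
  refine h.continuousOn_mul fun x hx => ContinuousAt.continuousWithinAt ?_
  rw [Set.uIcc_of_le (by norm_num)] at hx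
  exact ((continuous_const.sub continuous_id).continuousAt).rpow_const
    (Or.inl (by simp only [Pi.sub_apply, id]; linarith [hx.2]))

theorem integrableOn_jacobiWeight {a b : ℝ} (ha : -1 < a) (hb : -1 < b) :
    IntegrableOn (jacobiWeight a b) (Set.Icc (-1) 1) := by
  have h1 := intervalIntegrable_jacobiWeight_left a hb
  have h2 : IntervalIntegrable (jacobiWeight a b) volume 0 1 := by
    have h := (intervalIntegrable_jacobiWeight_left b ha).comp_sub_left 0
    norm_num at h
    refine (h.congr fun x _ => ?_).symm
    simp only [jacobiWeight, sub_neg_eq_add, ← sub_eq_add_neg]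
    rw [mul_comm]
  have h3 := (intervalIntegrable_iff_integrableOn_Ioc_of_le (by norm_num)).1 (h1.trans h2)
  exact (integrableOn_Icc_iff_integrableOn_Ioc (by simp)).2 h3

theorem isWeight_jacobiWeight {a b : ℝ} (ha : -1 < a) (hb : -1 < b) :
    IsWeight (Set.Icc (-1) 1) (jacobiWeight a b) where
  interval := Set.ordConnected_Icc
  nondegenerate := by rw [interior_Icc]; exact ⟨0, by norm_num⟩
  bounded := Metric.isBounded_Icc _ _
  measurable := (measurable_jacobiWeight a b).aemeasurable
  pos := fun x hx => jacobiWeight_pos a b (by rwa [interior_Icc] at hx)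
  moments := fun q => by
    have := integrableOn_mul_continuous (Metric.isBounded_Icc _ _) measurableSet_Icc
      (integrableOn_jacobiWeight ha hb) (p := fun x => |x| ^ q) (by fun_prop)
    simpa only [mul_comm] using this

theorem restrict_Icc_eq_Ioo :
    (volume.restrict (Set.Icc (-1 : ℝ) 1)) = volume.restrict (Set.Ioo (-1 : ℝ) 1) :=
  Measure.restrict_congr_set Ioo_ae_eq_Icc.symm

theorem ae_mem_Ioo : ∀ᵐ x ∂volume.restrict (Set.Icc (-1 : ℝ) 1), x ∈ Set.Ioo (-1 : ℝ) 1 := by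
  rw [restrict_Icc_eq_Ioo]; exact ae_restrict_mem measurableSet_Ioo

theorem jacobiWeight_succ_le (a b : ℝ) {x : ℝ} (hx : x ∈ Set.Ioo (-1 : ℝ) 1) :
    jacobiWeight (a + 1) (b + 1) x ≤ jacobiWeight a b x := by
  rw [jacobiWeight_succ a b hx]
  exact mul_le_of_le_one_left (jacobiWeight_pos a b hx).le (by linarith [sq_nonneg x])

theorem MemL2.jacobiWeight_succ {a b : ℝ} {f : ℝ → ℝ}
    (hf : MemL2 (Set.Icc (-1) 1) (jacobiWeight a b) f) :
    MemL2 (Set.Icc (-1) 1) (jacobiWeight (a + 1) (b + 1)) f := by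
  refine ⟨hf.1, Integrable.mono' hf.2
    ((hf.1.pow 2).mul (measurable_jacobiWeight _ _).aestronglyMeasurable) ?_⟩
  filter_upwards [ae_mem_Ioo] with x hx
  rw [Real.norm_eq_abs, abs_mul, abs_of_nonneg (sq_nonneg _),
    abs_of_pos (jacobiWeight_pos _ _ hx)]
  exact mul_le_mul_of_nonneg_left (jacobiWeight_succ_le a b hx) (sq_nonneg _)

theorem wInner_jacobiWeight_succ_le {a b : ℝ} {f : ℝ → ℝ}
    (hf : MemL2 (Set.Icc (-1) 1) (jacobiWeight a b) f) :
    wInner (Set.Icc (-1) 1) (jacobiWeight (a + 1) (b + 1)) f f ≤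
      wInner (Set.Icc (-1) 1) (jacobiWeight a b) f f := by
  have h' := hf.jacobiWeight_succ
  refine integral_mono_ae (h'.2.congr ?_) (hf.2.congr ?_) ?_
  · exact ae_of_all _ fun x => by simp only [pow_two]
  · exact ae_of_all _ fun x => by simp only [pow_two]
  filter_upwards [ae_mem_Ioo] with x hx
  exact mul_le_mul_of_nonneg_left (jacobiWeight_succ_le a b hx) (mul_self_nonneg _)

/-! ### Integration by parts against Jacobi weights -/

/-- The polynomial `J p` for which `(p w_{a+1,b+1})' = (J p) w_{a,b}`, where `w_{a,b}` is the Jacobi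
weight. -/
noncomputable def pearson (a b : ℝ) (p : ℝ[X]) : ℝ[X] :=
  (1 - X ^ 2) * derivative p + (C (b - a) - C (a + b + 2) * X) * p

theorem hasDerivAt_mul_jacobiWeight (a b : ℝ) (p : ℝ[X]) {x : ℝ} (hx : x ∈ Set.Ioo (-1 : ℝ) 1) :
    HasDerivAt (fun x => pfun p x * jacobiWeight (a + 1) (b + 1) x)
      (pfun (pearson a b p) x * jacobiWeight a b x) x := by
  have h1 : 1 - x ≠ 0 := by linarith [hx.2]
  have h2 : 1 + x ≠ 0 := by linarith [hx.1]
  have d1 := ((hasDerivAt_id x).const_sub 1).rpow_const (p := a + 1) (Or.inl h1)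
  have d2 := ((hasDerivAt_id x).const_add 1).rpow_const (p := b + 1) (Or.inl h2)
  refine ((p.hasDerivAt x).mul (d1.mul d2)).congr_deriv ?_
  simp only [id, add_sub_cancel_right, pfun, pearson, jacobiWeight, eval_add, eval_mul, eval_sub,
    eval_one, eval_pow, eval_X, eval_C, Pi.mul_apply, Real.rpow_add_one h1, Real.rpow_add_one h2]
  ring

theorem contDiffAt_jacobiWeight (a b : ℝ) {x : ℝ} (hx : x ∈ Set.Ioo (-1 : ℝ) 1) {n : ℕ∞} :
    ContDiffAt ℝ n (jacobiWeight a b) x :=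
  ((contDiffAt_const.sub contDiffAt_id).rpow_const_of_ne (by simp only [id]; linarith [hx.2])).mul
    ((contDiffAt_const.add contDiffAt_id).rpow_const_of_ne (by simp only [id]; linarith [hx.1]))

theorem contDiff_pfun (p : ℝ[X]) {n : WithTop ℕ∞} : ContDiff ℝ n (pfun p) := by
  have : pfun p = fun x => aeval x p := by ext x; simp [pfun]
  rw [this]
  exact p.contDiff_aeval n

/-- A smooth cutoff of the half line: `0` on `t ≤ 1` and `1` on `t ≥ 2`. -/
noncomputable def cutoff (t : ℝ) : ℝ := Real.smoothTransition (t - 1)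

theorem contDiff_cutoff : ContDiff ℝ (⊤ : ℕ∞) cutoff :=
  Real.smoothTransition.contDiff.comp (contDiff_id.sub contDiff_const)

theorem cutoff_eq_zero {t : ℝ} (ht : t ≤ 1) : cutoff t = 0 :=
  Real.smoothTransition.zero_of_nonpos (by linarith)

theorem cutoff_eq_one {t : ℝ} (ht : 2 ≤ t) : cutoff t = 1 :=
  Real.smoothTransition.one_of_one_le (by linarith)

theorem deriv_cutoff_eq_zero {t : ℝ} (ht : t ∉ Set.Icc (1 : ℝ) 2) : deriv cutoff t = 0 := by
  rcases lt_or_ge t 1 with h | h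
  · have : cutoff =ᶠ[nhds t] fun _ => 0 := by
      filter_upwards [gt_mem_nhds h] with s hs using cutoff_eq_zero hs.le
    rw [this.deriv_eq, deriv_const]
  · have h2 : 2 < t := by by_contra h3; exact ht ⟨h, not_lt.1 h3⟩
    have : cutoff =ᶠ[nhds t] fun _ => 1 := by
      filter_upwards [lt_mem_nhds h2] with s hs using cutoff_eq_one hs.le
    rw [this.deriv_eq, deriv_const]

theorem continuous_deriv_cutoff : Continuous (deriv cutoff) :=
  contDiff_cutoff.continuous_deriv (by simp)

/-- With `t = n (1 - x²)`, this bounds the derivative of the cutoff `cutoff (n (1 - x²))`, multiplied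
by the factor `1 - x²` of the weight, uniformly in `n`. -/
theorem exists_bound_mul_deriv_cutoff : ∃ B, 0 ≤ B ∧ ∀ t, |t * deriv cutoff t| ≤ B := by
  have hs : HasCompactSupport fun t => t * deriv cutoff t :=
    HasCompactSupport.intro isCompact_Icc fun t ht => by rw [deriv_cutoff_eq_zero ht, mul_zero]
  obtain ⟨B, hB⟩ := hs.exists_bound_of_continuous (continuous_id.mul continuous_deriv_cutoff)
  exact ⟨B, (norm_nonneg _).trans (hB 0), hB⟩

theorem tendsto_setIntegral_mul_of_bounded {U : Set ℝ} (hU : MeasurableSet U) {F : ℝ → ℝ}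
    (hF : IntegrableOn F U) {m : ℕ → ℝ → ℝ} {m' : ℝ → ℝ} {B : ℝ} (hm : ∀ n, Continuous (m n))
    (hB : ∀ n, ∀ x ∈ U, |m n x| ≤ B)
    (hlim : ∀ x ∈ U, Filter.Tendsto (fun n => m n x) Filter.atTop (nhds (m' x))) :
    Filter.Tendsto (fun n => ∫ x in U, F x * m n x) Filter.atTop
      (nhds (∫ x in U, F x * m' x)) := by
  refine tendsto_integral_of_dominated_convergence (fun x => |F x| * B)
    (fun n => hF.1.mul (hm n).aestronglyMeasurable) (hF.abs.mul_const B) (fun n => ?_) ?_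
  · filter_upwards [ae_restrict_mem hU] with x hx
    rw [Real.norm_eq_abs, abs_mul]
    exact mul_le_mul_of_nonneg_left (hB n x hx) (abs_nonneg _)
  · filter_upwards [ae_restrict_mem hU] with x hx
    exact (hlim x hx).const_mul _

/-- Integration by parts with a weak derivative on `(-1, 1)`.  There are no boundary terms although
nothing is known of `g` at the end points, because the weight gains a factor `1 - x²`. -/
theorem wInner_jacobi_integration_by_parts {a b : ℝ} (ha : -1 < a) (hb : -1 < b) {g g' : ℝ → ℝ}
    (h : IsWeakDeriv (Set.Ioo (-1) 1) 1 g g')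
    (hg : MemL2 (Set.Icc (-1) 1) (jacobiWeight a b) g)
    (hg' : MemL2 (Set.Icc (-1) 1) (jacobiWeight (a + 1) (b + 1)) g') (p : ℝ[X]) :
    wInner (Set.Icc (-1) 1) (jacobiWeight (a + 1) (b + 1)) g' (pfun p) =
      -wInner (Set.Icc (-1) 1) (jacobiWeight a b) g (pfun (pearson a b p)) := by
  have hw := isWeight_jacobiWeight ha hb
  have hw' := isWeight_jacobiWeight (show -1 < a + 1 by linarith) (show -1 < b + 1 by linarith)
  have hone : ∀ x, pfun (1 : ℝ[X]) x = 1 := fun x => by simp [pfun]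
  have hgi : IntegrableOn (fun x => g x * jacobiWeight a b x) (Set.Ioo (-1) 1) := by
    have := hg.integrable_mul hw (memL2_pfun hw 1)
    simp only [hone, mul_one] at this
    exact this.mono_set Set.Ioo_subset_Icc_self
  have hgi' : IntegrableOn (fun x => g' x * jacobiWeight (a + 1) (b + 1) x) (Set.Ioo (-1) 1) := by
    have := hg'.integrable_mul hw' (memL2_pfun hw' 1)
    simp only [hone, mul_one] at this
    exact this.mono_set Set.Ioo_subset_Icc_self
  -- Test the weak derivative with `cutoff (u n) p w_{a+1,b+1}`, which is smooth with compact support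
  -- in `(-1, 1)`, and let `n → ∞`.
  set u : ℕ → ℝ → ℝ := fun n x => (n + 1) * (1 - x ^ 2) with hu
  have huc : ∀ n, ContDiff ℝ (⊤ : ℕ∞) (u n) := fun n => by simp only [hu]; fun_prop
  have hθc : Continuous cutoff := contDiff_cutoff.continuous
  have hulim : ∀ x ∈ Set.Ioo (-1 : ℝ) 1, ∀ᶠ n in Filter.atTop, 2 < u n x := fun x hx => by
    have hx2 : 0 < 1 - x ^ 2 := by nlinarith [hx.1, hx.2]
    exact ((Filter.tendsto_atTop_add_const_right _ 1 tendsto_natCast_atTop_atTop).atTop_mul_const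
      hx2).eventually_gt_atTop 2
  have hθ1 : ∀ t, |cutoff t| ≤ 1 := fun t => by
    rw [cutoff, abs_of_nonneg (Real.smoothTransition.nonneg _)]; exact Real.smoothTransition.le_one _
  set ψ : ℕ → ℝ → ℝ := fun n x =>
    cutoff (u n x) * (pfun p x * jacobiWeight (a + 1) (b + 1) x) with hψ
  have hsub : ∀ n, tsupport (ψ n) ⊆ {x | 1 ≤ u n x} := fun n => by
    refine closure_minimal (fun x hx => ?_) (isClosed_le continuous_const (huc n).continuous)
    by_contra hx'
    exact hx (by simp only [hψ]; rw [cutoff_eq_zero (not_le.1 hx').le, zero_mul])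
  have hsub' : ∀ n, {x | 1 ≤ u n x} ⊆ Set.Ioo (-1) 1 := fun n x hx => by
    have h1 : (1 : ℝ) ≤ (n + 1) * (1 - x ^ 2) := hx
    have h2 : (0 : ℝ) < n + 1 := by positivity
    have h3 : 0 < 1 - x ^ 2 := by
      by_contra h3
      nlinarith [mul_nonneg h2.le (neg_nonneg.2 (not_lt.1 h3))]
    exact abs_lt.1 ((sq_lt_one_iff_abs_lt_one x).1 (by linarith))
  have hψc : ∀ n, ContDiff ℝ (⊤ : ℕ∞) (ψ n) := fun n => by
    refine contDiff_iff_contDiffAt.2 fun x => ?_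
    by_cases hx : x ∈ Set.Ioo (-1 : ℝ) 1
    · exact (contDiff_cutoff.comp (huc n)).contDiffAt.mul
        ((contDiff_pfun p).contDiffAt.mul (contDiffAt_jacobiWeight _ _ hx))
    · refine (contDiffAt_const (c := (0 : ℝ))).congr_of_eventuallyEq ?_
      have hx1 : u n x < 1 := by
        by_contra h1
        exact hx (hsub' n (not_lt.1 h1))
      filter_upwards [(huc n).continuous.continuousAt.eventually_lt_const hx1] with y hy
      simp only [hψ]
      rw [cutoff_eq_zero hy.le, zero_mul]
  have hψs : ∀ n, HasCompactSupport (ψ n) := fun n =>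
    HasCompactSupport.of_support_subset_isCompact isCompact_Icc
      ((subset_tsupport _).trans ((hsub n).trans ((hsub' n).trans Set.Ioo_subset_Icc_self)))
  have hψd : ∀ n, ∀ x ∈ Set.Ioo (-1 : ℝ) 1, deriv (ψ n) x =
      jacobiWeight a b x * (cutoff (u n x) * pfun (pearson a b p) x +
        (-2 * x * pfun p x) * (u n x * deriv cutoff (u n x))) := fun n x hx => by
    have d1 : HasDerivAt (u n) ((n + 1) * (-(2 * x))) x := by
      have := ((hasDerivAt_pow 2 x).const_sub 1).const_mul ((n : ℝ) + 1)
      simpa using this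
    have d2 := ((contDiff_cutoff.differentiable (by simp) (u n x)).hasDerivAt).comp x d1
    have d3 : deriv (ψ n) x = _ := (d2.mul (hasDerivAt_mul_jacobiWeight a b p hx)).deriv
    rw [d3, jacobiWeight_succ a b hx]
    simp only [hu, Function.comp]; ring
  obtain ⟨B, hB0, hB⟩ := exists_bound_mul_deriv_cutoff
  have hbd := Metric.isBounded_Icc (-1 : ℝ) 1
  obtain ⟨B₁, hB₁⟩ := exists_bound_of_continuous hbd (continuous_pfun (pearson a b p))
  obtain ⟨B₂, hB₂⟩ := exists_bound_of_continuous hbd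
    (p := fun x => -2 * x * pfun p x) (by have := continuous_pfun p; fun_prop)
  obtain ⟨B₃, hB₃⟩ := exists_bound_of_continuous hbd (continuous_pfun p)
  have lim1 := tendsto_setIntegral_mul_of_bounded measurableSet_Ioo hgi
    (m := fun n x => cutoff (u n x) * pfun (pearson a b p) x +
        (-2 * x * pfun p x) * (u n x * deriv cutoff (u n x)))
    (m' := pfun (pearson a b p)) (B := 1 * B₁ + B₂ * B)
    (fun n => by
      have h1 := continuous_pfun (pearson a b p)
      have h2 := continuous_pfun p
      have h3 := (huc n).continuous
      have h4 := continuous_deriv_cutoff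
      fun_prop)
    (fun n x hx => by
      have hx' := Set.Ioo_subset_Icc_self hx
      refine (abs_add_le _ _).trans (add_le_add ?_ ?_)
      · rw [abs_mul]
        exact mul_le_mul (hθ1 _) (hB₁ x hx') (abs_nonneg _) zero_le_one
      · rw [abs_mul]
        exact mul_le_mul (hB₂ x hx') (hB _) (abs_nonneg _) ((norm_nonneg _).trans (hB₂ x hx')))
    (fun x hx => by
      refine tendsto_const_nhds.congr' ?_
      filter_upwards [hulim x hx] with n hn
      rw [cutoff_eq_one hn.le, deriv_cutoff_eq_zero fun h => hn.not_ge h.2]; ring)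
  have lim2 := tendsto_setIntegral_mul_of_bounded measurableSet_Ioo hgi'
    (m := fun n x => cutoff (u n x) * pfun p x) (m' := pfun p) (B := 1 * B₃)
    (fun n => by
      have h2 := continuous_pfun p
      have h3 := (huc n).continuous
      fun_prop)
    (fun n x hx => by
      rw [abs_mul]
      exact mul_le_mul (hθ1 _) (hB₃ x (Set.Ioo_subset_Icc_self hx)) (abs_nonneg _) zero_le_one)
    (fun x hx => by
      refine tendsto_const_nhds.congr' ?_
      filter_upwards [hulim x hx] with n hn
      rw [cutoff_eq_one hn.le, one_mul])
  have heq : ∀ n, (∫ x in Set.Ioo (-1 : ℝ) 1, g x * jacobiWeight a b x *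
        (cutoff (u n x) * pfun (pearson a b p) x +
          (-2 * x * pfun p x) * (u n x * deriv cutoff (u n x)))) =
      -∫ x in Set.Ioo (-1 : ℝ) 1, g' x * jacobiWeight (a + 1) (b + 1) x *
        (cutoff (u n x) * pfun p x) := fun n => by
    have e := h.2.2 (ψ n) (hψc n) (hψs n) ((hsub n).trans (hsub' n))
    rw [iteratedDeriv_one, pow_one, neg_one_mul] at e
    convert e using 1
    · refine setIntegral_congr_fun measurableSet_Ioo fun x hx => ?_
      simp only [hψd n x hx, mul_assoc]
    · congr 1
      refine setIntegral_congr_fun measurableSet_Ioo fun x hx => ?_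
      simp only [hψ]; ring
  have e := tendsto_nhds_unique (lim1.congr heq) lim2.neg
  rw [wInner, wInner, restrict_Icc_eq_Ioo]
  have e1 : ∀ x, g' x * pfun p x * jacobiWeight (a + 1) (b + 1) x =
    g' x * jacobiWeight (a + 1) (b + 1) x * pfun p x := fun x => by ring
  have e2 : ∀ x, g x * pfun (pearson a b p) x * jacobiWeight a b x =
    g x * jacobiWeight a b x * pfun (pearson a b p) x := fun x => by ring
  simp only [e1, e2]
  linarith

/-! ### Derivatives of Jacobi polynomials -/

/-- `p ↦ J p'` is triangular in the monomial basis, with diagonal entries `-m (m + a + b + 1)`. -/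
theorem coeff_pearson_derivative (a b : ℝ) {p : ℝ[X]} {m : ℕ} (hp : ∀ n, m < n → p.coeff n = 0) :
    (pearson a b (derivative p)).coeff m = -(m * (m + a + b + 1)) * p.coeff m := by
  have hE : ∀ q : ℝ[X], (X * derivative q).coeff m = m * q.coeff m := fun q => by
    cases m with
    | zero => simp
    | succ m => rw [coeff_X_mul, coeff_derivative]; push_cast; ring
  have e : pearson a b (derivative p) = derivative (derivative p) + C (b - a) * derivative p
      - (X * derivative (X * derivative p) - X * derivative p)
      - C (a + b + 2) * (X * derivative p) := by
    simp only [pearson, derivative_mul, derivative_X]; ring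
  rw [e]
  simp only [coeff_sub, coeff_add, coeff_C_mul, hE, coeff_derivative, hp (m + 1) (by omega),
    hp (m + 1 + 1) (by omega)]
  ring

theorem degree_pearson_derivative_lt (a b : ℝ) {p : ℝ[X]} {k : ℕ} (hp : p.degree < k) :
    (pearson a b (derivative p)).degree < k := by
  rw [degree_lt_iff_coeff_zero] at hp ⊢
  intro m hm
  rw [coeff_pearson_derivative a b fun n hn => hp n (hm.trans hn.le), hp m hm, mul_zero]

/-- The Sturm–Liouville equation of the Jacobi polynomials. -/
theorem pearson_derivative_eq {a b : ℝ} (ha : -1 < a) (hb : -1 < b)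
    (hφ : IsOrthogonalFamily (Set.Icc (-1) 1) (jacobiWeight a b) φ) (k : ℕ) :
    pearson a b (derivative (φ k)) = -(k * (k + a + b + 1) : ℝ) • φ k := by
  have hw := isWeight_jacobiWeight ha hb
  have hw' := isWeight_jacobiWeight (show -1 < a + 1 by linarith) (show -1 < b + 1 by linarith)
  have hpp : ∀ p q : ℝ[X], wInner (Set.Icc (-1) 1) (jacobiWeight (a + 1) (b + 1))
      (pfun (derivative q)) (pfun (derivative p)) = -wInner (Set.Icc (-1) 1) (jacobiWeight a b)
        (pfun q) (pfun (pearson a b (derivative p))) := fun p q =>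
    wInner_jacobi_integration_by_parts ha hb (isWeakDeriv_pfun q) (memL2_pfun hw _)
      (memL2_pfun hw' _) _
  -- The difference of the two sides has degree `< k`; by symmetry of `p ↦ J p'` it is orthogonal
  -- to itself.
  set R := pearson a b (derivative (φ k)) + (k * (k + a + b + 1) : ℝ) • φ k with hR
  have hcoeff : ∀ n, k < n → (φ k).coeff n = 0 := fun n hn =>
    coeff_eq_zero_of_degree_lt (by rw [hφ.degree]; exact_mod_cast hn)
  have hRd : R.degree < k := by
    rw [degree_lt_iff_coeff_zero]
    intro m hm
    rw [hR, coeff_add, coeff_smul, smul_eq_mul,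
      coeff_pearson_derivative a b fun n hn => hcoeff n (hm.trans_lt hn)]
    rcases hm.eq_or_lt with rfl | hm
    · ring
    · rw [hcoeff m hm]; ring
  have hRR : wInner (Set.Icc (-1) 1) (jacobiWeight a b) (pfun R) (pfun R) = 0 := by
    have h1 := hφ.wInner_eq_zero hw hRd
    have h2 := hφ.wInner_eq_zero hw (degree_pearson_derivative_lt a b hRd)
    have h3 := hpp (φ k) R
    rw [wInner_comm, hpp R (φ k), wInner_comm, h2, neg_zero, wInner_comm] at h3
    conv_lhs => enter [3]; rw [hR, pfun_add, pfun_smul]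
    rw [wInner_add_left hw (memL2_pfun hw _) ((memL2_pfun hw _).smul _) (memL2_pfun hw _),
      wInner_smul_left, wInner_comm (pfun (φ k)), h1]
    linarith
  have hR0 : R = 0 := by
    by_contra hne
    exact (wInner_self_pos hw hne).ne' hRR
  rw [neg_smul]
  exact eq_neg_of_add_eq_zero_left hR0

theorem wInner_derivative {a b : ℝ} (ha : -1 < a) (hb : -1 < b)
    (hφ : IsOrthogonalFamily (Set.Icc (-1) 1) (jacobiWeight a b) φ) {g g' : ℝ → ℝ}
    (h : IsWeakDeriv (Set.Ioo (-1) 1) 1 g g')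
    (hg : MemL2 (Set.Icc (-1) 1) (jacobiWeight a b) g)
    (hg' : MemL2 (Set.Icc (-1) 1) (jacobiWeight (a + 1) (b + 1)) g') (k : ℕ) :
    wInner (Set.Icc (-1) 1) (jacobiWeight (a + 1) (b + 1)) g' (pfun (derivative (φ k))) =
      k * (k + a + b + 1) * wInner (Set.Icc (-1) 1) (jacobiWeight a b) g (pfun (φ k)) := by
  rw [wInner_jacobi_integration_by_parts ha hb h hg hg', pearson_derivative_eq ha hb hφ, pfun_smul,
    wInner_comm, wInner_smul_left, wInner_comm]
  ring

theorem wInner_derivative_pfun {a b : ℝ} (ha : -1 < a) (hb : -1 < b)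
    (hφ : IsOrthogonalFamily (Set.Icc (-1) 1) (jacobiWeight a b) φ) (p : ℝ[X]) (k : ℕ) :
    wInner (Set.Icc (-1) 1) (jacobiWeight (a + 1) (b + 1)) (pfun (derivative p))
        (pfun (derivative (φ k))) =
      k * (k + a + b + 1) * wInner (Set.Icc (-1) 1) (jacobiWeight a b) (pfun p) (pfun (φ k)) :=
  wInner_derivative ha hb hφ (isWeakDeriv_pfun p) (memL2_pfun (isWeight_jacobiWeight ha hb) _)
    (memL2_pfun (isWeight_jacobiWeight (by linarith) (by linarith)) _) k

/-- The derivatives of the Jacobi polynomials are Jacobi polynomials for the parameters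
`a + 1`, `b + 1`. -/
theorem IsOrthogonalFamily.derivative {a b : ℝ} (ha : -1 < a) (hb : -1 < b)
    (hφ : IsOrthogonalFamily (Set.Icc (-1) 1) (jacobiWeight a b) φ) :
    IsOrthogonalFamily (Set.Icc (-1) 1) (jacobiWeight (a + 1) (b + 1))
      (fun k => Polynomial.derivative (φ (k + 1))) where
  degree := fun k => by
    have hn : (φ (k + 1)).natDegree = k + 1 := natDegree_eq_of_degree_eq_some (hφ.degree _)
    rw [degree_derivative (by omega), hn, Nat.add_sub_cancel]
  orthogonal := fun h k hne => by
    rw [wInner_derivative_pfun ha hb hφ, hφ.orthogonal _ _ (by omega), mul_zero]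

theorem energy_derivative {a b : ℝ} (ha : -1 < a) (hb : -1 < b)
    (hφ : IsOrthogonalFamily (Set.Icc (-1) 1) (jacobiWeight a b) φ) {g g' : ℝ → ℝ}
    (h : IsWeakDeriv (Set.Ioo (-1) 1) 1 g g')
    (hg : MemL2 (Set.Icc (-1) 1) (jacobiWeight a b) g)
    (hg' : MemL2 (Set.Icc (-1) 1) (jacobiWeight (a + 1) (b + 1)) g') (k : ℕ) :
    energy (Set.Icc (-1) 1) (jacobiWeight (a + 1) (b + 1))
        (fun k => Polynomial.derivative (φ (k + 1))) g' k =
      (k + 1) * (k + a + b + 2) * energy (Set.Icc (-1) 1) (jacobiWeight a b) φ g (k + 1) := by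
  have h1 := (hφ.norm_pos (isWeight_jacobiWeight ha hb) (k + 1)).ne'
  have h2 : (k + a + b + 2 : ℝ) ≠ 0 := by
    have : (0 : ℝ) ≤ k := k.cast_nonneg
    linarith
  have h3 : (k + 1 : ℝ) ≠ 0 := by positivity
  rw [energy, energy, wInner_derivative ha hb hφ h hg hg', wInner_derivative_pfun ha hb hφ]
  push_cast
  rw [show (k + 1 + a + b + 1 : ℝ) = k + a + b + 2 by ring]
  field_simp

/-! ### Spectral accuracy of Jacobi expansions -/

/-- Each derivative multiplies the energies by at least the square of the degree, and lowers the
degree by one. -/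
theorem exists_family_energy_le {a b : ℝ} (ha : -1 < a) (hb : -1 < b)
    (hφ : IsOrthogonalFamily (Set.Icc (-1) 1) (jacobiWeight a b) φ) {r : ℕ} {g : ℕ → ℝ → ℝ}
    (hd : ∀ j < r, IsWeakDeriv (Set.Ioo (-1) 1) 1 (g j) (g (j + 1)))
    (hg : ∀ j ≤ r, MemL2 (Set.Icc (-1) 1) (jacobiWeight (a + j) (b + j)) (g j)) :
    ∀ j ≤ r, ∃ ψ : ℕ → ℝ[X],
      IsOrthogonalFamily (Set.Icc (-1) 1) (jacobiWeight (a + j) (b + j)) ψ ∧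
      ∀ k : ℕ, (k : ℝ) ^ (2 * j) *
          energy (Set.Icc (-1) 1) (jacobiWeight a b) φ (g 0) (k + j) ≤
        energy (Set.Icc (-1) 1) (jacobiWeight (a + j) (b + j)) ψ (g j) k := by
  intro j
  induction j with
  | zero => exact fun _ => ⟨φ, by simpa using hφ, fun k => by simp⟩
  | succ j ih =>
    intro hj
    obtain ⟨ψ, hψ, hle⟩ := ih (by omega)
    have hj0 : (0 : ℝ) ≤ j := j.cast_nonneg
    have ha' : -1 < a + j := by linarith
    have hb' : -1 < b + j := by linarith
    have e1 : ∀ c : ℝ, c + ((j + 1 : ℕ) : ℝ) = c + j + 1 := fun c => by push_cast; ring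
    have hg' := hg (j + 1) hj
    rw [e1, e1] at hg'
    rw [e1, e1]
    refine ⟨_, hψ.derivative ha' hb', fun k => ?_⟩
    rw [energy_derivative ha' hb' hψ (hd j (by omega)) (hg j (by omega)) hg']
    have h1 := hle (k + 1)
    rw [show k + 1 + j = k + (j + 1) by ring] at h1
    have hk : (0 : ℝ) ≤ k := k.cast_nonneg
    have hE := energy_nonneg (φ := φ) (f := g 0) (isWeight_jacobiWeight ha hb) (k + (j + 1))
    have h2 : (k : ℝ) ^ 2 ≤ (k + 1) * (k + (a + j) + (b + j) + 2) := by nlinarith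
    have h3 : (k : ℝ) ^ (2 * j) ≤ ((k + 1 : ℕ) : ℝ) ^ (2 * j) := by
      push_cast
      exact pow_le_pow_left₀ hk (by linarith) _
    calc (k : ℝ) ^ (2 * (j + 1)) *
          energy (Set.Icc (-1) 1) (jacobiWeight a b) φ (g 0) (k + (j + 1))
        = (k : ℝ) ^ 2 * ((k : ℝ) ^ (2 * j) *
          energy (Set.Icc (-1) 1) (jacobiWeight a b) φ (g 0) (k + (j + 1))) := by ring
      _ ≤ (k + 1) * (k + (a + j) + (b + j) + 2) * (((k + 1 : ℕ) : ℝ) ^ (2 * j) *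
          energy (Set.Icc (-1) 1) (jacobiWeight a b) φ (g 0) (k + (j + 1))) :=
        mul_le_mul h2 (mul_le_mul_of_nonneg_right h3 hE) (by positivity) ((sq_nonneg _).trans h2)
      _ ≤ _ := mul_le_mul_of_nonneg_left h1 ((sq_nonneg _).trans h2)

theorem wInner_jacobiWeight_add_le {a b : ℝ} {f : ℝ → ℝ}
    (hf : MemL2 (Set.Icc (-1) 1) (jacobiWeight a b) f) (j : ℕ) :
    MemL2 (Set.Icc (-1) 1) (jacobiWeight (a + j) (b + j)) f ∧
      wInner (Set.Icc (-1) 1) (jacobiWeight (a + j) (b + j)) f f ≤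
        wInner (Set.Icc (-1) 1) (jacobiWeight a b) f f := by
  induction j with
  | zero => simpa using hf
  | succ j ih =>
    have e : ∀ c : ℝ, c + ((j + 1 : ℕ) : ℝ) = c + j + 1 := fun c => by push_cast; ring
    rw [e, e]
    exact ⟨ih.1.jacobiWeight_succ, (wInner_jacobiWeight_succ_le ih.1).trans ih.2⟩

/-- Jacobi expansions are spectrally accurate.  For `N ≥ 2 r`, a neglected mode of degree `n > N`
corresponds to a mode of degree `n - r ≥ N / 2` of the `r`-th derivative. -/
theorem truncationAccuracy_jacobi {a b : ℝ} (ha : -1 < a) (hb : -1 < b)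
    (hφ : IsOrthogonalFamily (Set.Icc (-1) 1) (jacobiWeight a b) φ) {r N : ℕ} (hN : 1 ≤ N)
    {f : ℝ → ℝ} (hf : MemSobolev (Set.Icc (-1) 1) (jacobiWeight a b) r f) :
    TruncationAccuracy (Set.Icc (-1) 1) (jacobiWeight a b) φ r N (2 ^ r + (2 * r) ^ r) f := by
  have hw := isWeight_jacobiWeight ha hb
  set g : ℕ → ℝ → ℝ := fun j => weakDeriv (interior (Set.Icc (-1) 1)) j f with hgdef
  set s := sobolevNorm (Set.Icc (-1) 1) (jacobiWeight a b) r f with hs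
  have hN0 : (0 : ℝ) < N := by exact_mod_cast hN
  have hs0 : 0 ≤ s := Real.sqrt_nonneg _
  have hgs : ∀ j ≤ r, wInner (Set.Icc (-1) 1) (jacobiWeight a b) (g j) (g j) ≤ s ^ 2 := fun j hj =>
    (wNorm_sq hw _).symm.trans_le
      (pow_le_pow_left₀ (wNorm_nonneg _) (wNorm_weakDeriv_le_sobolevNorm hj) 2)
  have hfg := hf.weakDeriv_zero hw
  have hen : ∀ k, energy (Set.Icc (-1) 1) (jacobiWeight a b) φ f k =
      energy (Set.Icc (-1) 1) (jacobiWeight a b) φ (g 0) k := fun k => by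
    rw [energy, energy, wInner_congr_ae hfg]
  have h2 : (0 : ℝ) ≤ 2 ^ r := by positivity
  have h3 : (0 : ℝ) ≤ (2 * r) ^ r := by positivity
  -- The summand `2 ^ r` of the constant serves for `N ≥ 2 r`; for `N < 2 r` the trivial bound
  -- `‖f - f_N‖ ≤ ‖f‖` suffices, since `N ^ r ≤ (2 r) ^ r`.
  suffices h : ∃ c : ℝ, 0 ≤ c ∧ c ≤ 2 ^ r + (2 * r) ^ r ∧
      ∀ K, ∑ k ∈ Finset.Ico (N + 1) K, energy (Set.Icc (-1) 1) (jacobiWeight a b) φ f k ≤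
        (c / N ^ r * s) ^ 2 by
    obtain ⟨c, hc0, hc, hK⟩ := h
    have := wInner_sub_truncation_le_of_sum_energy_le hw hφ hf.1 hK
    rw [TruncationAccuracy, wNorm, ← hs]
    refine (Real.sqrt_le_sqrt this).trans ?_
    rw [Real.sqrt_sq (by positivity)]
    gcongr
  rcases le_or_gt (2 * r) N with hNr | hNr
  · refine ⟨2 ^ r, h2, by linarith, fun K => ?_⟩
    obtain ⟨ψ, hψ, hle⟩ := exists_family_energy_le ha hb hφ (r := r) (g := g)
      (fun j hj => by
        rw [← interior_Icc]
        exact (hf.isWeakDeriv hj.le).step (hf.isWeakDeriv hj))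
      (fun j hj => (wInner_jacobiWeight_add_le (hf.memL2_weakDeriv hw hj) j).1) r le_rfl
    have hr0 : (0 : ℝ) ≤ r := r.cast_nonneg
    have hwr := isWeight_jacobiWeight (show -1 < a + r by linarith) (show -1 < b + r by linarith)
    obtain ⟨hm, hmle⟩ := wInner_jacobiWeight_add_le (hf.memL2_weakDeriv hw (le_refl r)) r
    have key : (N / 2 : ℝ) ^ (2 * r) *
        ∑ k ∈ Finset.Ico (N + 1) K, energy (Set.Icc (-1) 1) (jacobiWeight a b) φ f k ≤ s ^ 2 := by
      have hinj : Set.InjOn (fun n => n - r) (Finset.Ico (N + 1) K : Set ℕ) := by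
        intro m hm n hn hmn
        simp only [Finset.coe_Ico, Set.mem_Ico] at hm hn
        simp only at hmn
        omega
      refine le_trans ?_ ((sum_energy_le hwr hψ hm
        ((Finset.Ico (N + 1) K).image fun n => n - r)).trans (hmle.trans (hgs r le_rfl)))
      rw [Finset.mul_sum, Finset.sum_image hinj]
      refine Finset.sum_le_sum fun n hn => ?_
      have hn1 := (Finset.mem_Ico.1 hn).1
      have h4 := hle (n - r)
      rw [Nat.sub_add_cancel (by omega)] at h4
      refine le_trans ?_ h4
      rw [hen]
      refine mul_le_mul_of_nonneg_right (pow_le_pow_left₀ (by positivity) ?_ _)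
        (energy_nonneg hw _)
      rw [div_le_iff₀ two_pos]
      exact_mod_cast (show N ≤ (n - r) * 2 by omega)
    have h5 : (2 ^ r / N ^ r * s : ℝ) ^ 2 = s ^ 2 / (N / 2) ^ (2 * r) := by
      rw [← div_pow, mul_pow, ← pow_mul, mul_comm r 2, div_eq_mul_inv (s ^ 2), ← inv_pow, inv_div,
        mul_comm]
    rw [h5, le_div_iff₀ (by positivity), mul_comm]
    exact key
  · refine ⟨(2 * r) ^ r, h3, by linarith, fun K => ?_⟩
    simp only [hen]
    refine (sum_energy_le hw hφ (hf.memL2_weakDeriv hw (Nat.zero_le r)) _).trans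
      ((hgs 0 (Nat.zero_le r)).trans (pow_le_pow_left₀ hs0 ?_ 2))
    refine le_mul_of_one_le_left hs0 ((one_le_div (by positivity)).2 ?_)
    exact pow_le_pow_left₀ hN0.le (by exact_mod_cast hNr.le) r

end ConservativeApprox

theorem mainTheorem1 :
    -- Jacobi weights: spectral accuracy of `f_N^c`
    (∀ α β : ℝ, -1 < α → -1 < β → ∀ (r : ℕ) (C : ℝ), 0 < C →
      ∃ K : ℝ → ℝ → ℝ, Monotone (Function.uncurry K) ∧
        ∀ φ : ℕ → Polynomial ℝ, IsOrthogonalFamily (Set.Icc (-1) 1) (jacobiWeight α β) φ →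
        ∀ Q N : ℕ, Q ≤ N → 1 ≤ N →
        ∀ f : ℝ → ℝ, MemSobolev (Set.Icc (-1) 1) (jacobiWeight α β) r f →
          MeasureTheory.IntegrableOn f (Set.Icc (-1) 1) →
          MomentAccuracy (Set.Icc (-1) 1) (jacobiWeight α β) φ r Q N C f →
          wNorm (Set.Icc (-1) 1) (jacobiWeight α β)
              (f - constrainedProj (Set.Icc (-1) 1) (jacobiWeight α β) φ Q N f) ≤
            K (invSpectralRadius (Set.Icc (-1) 1) (jacobiWeight α β) φ Q N)
                (phiNorm (Set.Icc (-1) 1) (jacobiWeight α β) Q) / (N : ℝ) ^ r *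
              sobolevNorm (Set.Icc (-1) 1) (jacobiWeight α β) r f) ∧
    -- general weights: the same whenever `f_N` itself is spectrally accurate
    (∀ C₀ C : ℝ, 0 < C₀ → 0 < C →
      ∃ K : ℝ → ℝ → ℝ, Monotone (Function.uncurry K) ∧
        ∀ (Ω : Set ℝ) (w : ℝ → ℝ), IsWeight Ω w →
        ∀ φ : ℕ → Polynomial ℝ, IsOrthogonalFamily Ω w φ →
        ∀ r Q N : ℕ, Q ≤ N → 1 ≤ N →
        ∀ f : ℝ → ℝ, MemSobolev Ω w r f → MeasureTheory.IntegrableOn f Ω →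
          TruncationAccuracy Ω w φ r N C₀ f →
          MomentAccuracy Ω w φ r Q N C f →
          wNorm Ω w (f - constrainedProj Ω w φ Q N f) ≤
            K (invSpectralRadius Ω w φ Q N) (phiNorm Ω w Q) / (N : ℝ) ^ r *
              sobolevNorm Ω w r f) ∧
    -- `f_N^c` is well defined and is the constrained best approximation
    (∀ (Ω : Set ℝ) (w : ℝ → ℝ), IsWeight Ω w →
        ∀ φ : ℕ → Polynomial ℝ, IsOrthogonalFamily Ω w φ →
        ∀ Q N : ℕ, Q ≤ N →
          (constraintMatrix Ω w φ Q N).PosDef ∧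
          ∀ f : ℝ → ℝ, MemL2 Ω w f → MeasureTheory.IntegrableOn f Ω →
            IsConstrainedBestApprox Ω w φ Q N f (constrainedProj Ω w φ Q N f)) := by
  refine ⟨fun α β hα hβ r C hC => ?_, fun C₀ C _ hC => ?_, fun Ω w hw φ hφ Q N hQN => ?_⟩
  · refine ⟨errorConst (2 ^ r + (2 * r) ^ r) C, monotone_errorConst _ hC, ?_⟩
    intro φ hφ Q N hQN hN f hf _ hm
    exact constrainedProj_error_le (isWeight_jacobiWeight hα hβ) hφ hQN hf.1
      (truncationAccuracy_jacobi hα hβ hφ hN hf) hm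
  · refine ⟨errorConst C₀ C, monotone_errorConst _ hC, ?_⟩
    intro Ω w hw φ hφ r Q N hQN _ f hf _ ht hm
    exact constrainedProj_error_le hw hφ hQN hf.1 ht hm
  · exact ⟨constraintMatrix_posDef hw hφ hQN, fun f hf _ =>
      constrainedProj_isConstrainedBestApprox hw hφ hQN hf⟩
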